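/- **Setting.** Let $n\in\{2,3\}$, let $\Omega\subset\mathbb R^n$ be bounded and open, $\Omega_d\subset\Omega$ measurable, $D=\Omega\setminus\Omega_d$, $\epsilon>0$, $H_\epsilon(x)=\{y:|y-x|<\epsilon\}$, $J^\epsilon(r)=J(r/\epsilon)$ with $J\ge 0$ bounded, measurable and supported on $[0,1]$, and let $\omega_n$ be the volume of the unit ball. Let $g:\mathbb R\to\mathbb R$ be three times differentiable with $g,g',g'',g'''$ bounded, $g(0)=0$, $g(r)>0$ for $r\neq0$, $g$ convex on $[r^e,r^c]$ (where $r^e<0<r^c$) and concave on $(-\infty,r^e]$ and on $[r^c,\infty)$, with finite limits at $\pm\infty$, and $\max|g''|=g''(0)$. Put $$e_{y-x}=\frac{y-x}{|y-x|},\qquad S(y,x,u)=\frac{u(y)-u(x)}{|y-x|}\cdot e_{y-x}.$$ Let $\mathcal V$ (resp. $\mathcal B$) be the space of $v\in L^\infty(\Omega,\mathbb R^n)$ that vanish on $\Omega_d$ (resp. on $D$). For a measurable set $\Sigma$ of broken bonds $(y,x)$ with $\chi=1-1_\Sigma$, define for $x\in D$ $$\mathcal L_\Sigma[u](x)=-\int_{H_\epsilon(x)\cap\Omega}2\chi(y,x)\frac{J^\epsilon(|y-x|)}{\epsilon^{n+1}\omega_n\sqrt{|y-x|}}\,g'\big(\sqrt{|y-x|}\,S(y,x,u)\big)\,e_{y-x}\,dy,$$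 $$\mathcal L_\Sigma'[u]w(x)=-\int_{H_\epsilon(x)\cap\Omega}2\chi(y,x)\frac{J^\epsilon(|y-x|)}{\epsilon^{n+1}\omega_n}\,g''\big(\sqrt{|y-x|}\,S(y,x,u)\big)\,S(y,x,w)\,e_{y-x}\,dy,$$ $$\mathbb A_\Sigma[u](x)=\int_{H_\epsilon(x)\cap\Omega}\chi(y,x)\frac{J^\epsilon(|y-x|)}{\epsilon^{n+1}\omega_n|y-x|}\,g''\big(\sqrt{|y-x|}\,S(y,x,u)\big)\,e_{y-x}\otimes e_{y-x}\,dy,$$ where $\mathcal L_\Sigma[u]$ and $\mathcal L_\Sigma'[u]w$ are extended by $0$ outside $D$. Then $\mathcal L_\Sigma$ maps $L^\infty(\Omega,\mathbb R^n)$ into $\mathcal V$, and $\mathcal L'_\Sigma[u]$ is a bounded operator on $\mathcal V$; $|||\cdot|||$ denotes the operator norm on $\mathcal V$. A displacement $u$ breaks the bond $(y,x)$, where $y\in\Omega$, $x\in D$, $|y-x|<\epsilon$, if $r=\sqrt{|y-x|}\,S(y,x,u)$ satisfies $g'(r)=0$ and ($r<r^e$ or $r>r^c$). Given displacements $u^1,\dots,u^N\in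 L^\infty(\Omega,\mathbb R^n)$ of the first $N$ load steps, let $S_0=\emptyset$, let $S_k$ be $S_{k-1}$ together with the bonds broken by $u^k$, and write $\mathcal L_k=\mathcal L_{S_k}$, $\mathcal L_k'=\mathcal L_{S_k}'$, $\mathbb A_k=\mathbb A_{S_k}$. **Hypotheses.** Suppose that $u^N=v^N+U^N$ with $v^N\in\mathcal V$, $U^N\in\mathcal B$, that $\mathcal L_N[u^N]=0$ a.e. on $D$, that for some $\gamma>0$ the matrix $\mathbb A_N[u^N](x)^2-\gamma^2\mathbb I$ is positive definite for a.e. $x\in D$, and that $\mathcal L_N'[u^N]$ has trivial kernel on the closure of $\mathcal V$ in $L^2(\Omega,\mathbb R^n)$. **Conclusion.** The operator $\mathcal L_N'[u^N]$ is boundedly invertible on $\mathcal V$, and there is $K>0$ with $$|||\mathcal L_N'[w]-\mathcal L_N'[w']|||\le K\|w-w'\|_\infty\quad\text{for all } w,w'\in L^\infty(\Omega,\mathbb R^n).\qquad(*)$$ Moreover, let $K>0$ satisfy $(*)$, let $\beta>|||\mathcal L_N'[u^N]^{-1}|||$, let $\eta>0$ be such that $h:=\beta K\eta<\tfrac12$,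 and put $$t^*=\frac{1-\sqrt{1-2h}}{\beta K},\qquad t^{**}=\frac{1+\sqrt{1-2h}}{\beta K},\qquad \overline{B(t,v^N)}=\{v\in\mathcal V:\|v-v^N\|_\infty\le t\}.$$ Then $0<t^*<t^{**}$, and there is $\delta>0$ such that for every $U^{N+1}\in\mathcal B$ with $\|U^{N+1}-U^N\|_\infty\le\delta$ the following hold, with $u_0=v^N+U^{N+1}$: 1. $\mathcal L_N'[u_0]$ is boundedly invertible on $\mathcal V$, $|||\mathcal L_N'[u_0]^{-1}|||<\beta$ and $\|\mathcal L_N'[u_0]^{-1}\mathcal L_N[u_0]\|_\infty\le\eta$. 2. $\mathcal L_N'[v+U^{N+1}]$ is boundedly invertible on $\mathcal V$ for every $v\in\overline{B(t^*,v^N)}$, so that the Newton map $T(v)=v-\mathcal L_N'[v+U^{N+1}]^{-1}\mathcal L_N[v+U^{N+1}]$ is defined on this ball. If $h<\tfrac49$, then $T$ maps $\overline{B(t^*,v^N)}$ into itself. 3. $T$ has exactly one fixed point $v^{N+1}$ in $\overline{B(t^*,v^N)}$. It is isolated: $\overline{B(t^{**},v^N)}$ contains no other fixed point of $T$ (among the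 $v$ for which $\mathcal L_N'[v+U^{N+1}]$ is boundedly invertible) and no other solution $v$ of $\mathcal L_N[v+U^{N+1}]=0$. 4. With $u^{N+1}=v^{N+1}+U^{N+1}$ one has $\mathcal L_N[u^{N+1}]=0$, and, if $\mathcal L_{N+1}$ is the operator obtained by breaking in addition the bonds broken by $u^{N+1}$, that is, with $S_{N+1}$ equal to $S_N$ together with these bonds, then $\mathcal L_{N+1}[u^{N+1}]=0$. -/

import Mathlib

open MeasureTheory Set Filter Topology
open scoped ENNReal Matrix

noncomputable section

namespace Peridynamics

/-- Euclidean space `ℝⁿ`. -/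
abbrev Space (n : ℕ) : Type := EuclideanSpace ℝ (Fin n)

/-- The data of the nonlocal fracture model: the dimension, the bounded open set `Ω`, the
interaction domain `Ωd ⊆ Ω` on which displacements are prescribed, the horizon `ε`, the influence
function `J` and the cohesive potential `g`, which is convex on `[rₑ, r_c]` and concave on either
side of that interval. -/
structure Model (n : ℕ) where
  dim : n = 2 ∨ n = 3
  Ω : Set (Space n)
  isOpen_Ω : IsOpen Ω
  bounded_Ω : Bornology.IsBounded Ω
  Ωd : Set (Space n)
  measurableSet_Ωd : MeasurableSet Ωd
  Ωd_subset : Ωd ⊆ Ω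
  ε : ℝ
  ε_pos : 0 < ε
  J : ℝ → ℝ
  measurable_J : Measurable J
  J_nonneg : ∀ r, 0 ≤ J r
  J_bounded : ∃ M, ∀ r, J r ≤ M
  J_support : ∀ r, r ∉ Icc (0 : ℝ) 1 → J r = 0
  g : ℝ → ℝ
  g_zero : g 0 = 0
  g_pos : ∀ r, r ≠ 0 → 0 < g r
  /-- `g`, `g'` and `g''` are differentiable. -/
  differentiable_g : ∀ k < 3, Differentiable ℝ (iteratedDeriv k g)
  /-- `g`, `g'`, `g''` and `g'''` are bounded. -/
  bounded_g : ∀ k ≤ 3, ∃ C, ∀ r, |iteratedDeriv k g r| ≤ C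
  re : ℝ
  rc : ℝ
  re_neg : re < 0
  rc_pos : 0 < rc
  convexOn_g : ConvexOn ℝ (Icc re rc) g
  concaveOn_g_left : ConcaveOn ℝ (Iic re) g
  concaveOn_g_right : ConcaveOn ℝ (Ici rc) g
  tendsto_g_atBot : ∃ C, Tendsto g atBot (𝓝 C)
  tendsto_g_atTop : ∃ C, Tendsto g atTop (𝓝 C)
  max_g'' : ∀ r, |iteratedDeriv 2 g r| ≤ iteratedDeriv 2 g 0

/-- The unit vector `e_{y-x}`. -/
def bondDir {n : ℕ} (y x : Space n) : Space n := ‖y - x‖⁻¹ • (y - x)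

/-- The nonlocal strain `S(y, x, u) = (u(y) - u(x)) / |y - x| ⋅ e_{y-x}`. -/
def strain {n : ℕ} (y x : Space n) (u : Space n → Space n) : ℝ :=
  inner ℝ (‖y - x‖⁻¹ • (u y - u x)) (bondDir y x)

/-- A measurable set of (broken) bonds `(y, x)`. -/
abbrev BondSet (n : ℕ) : Type := {S : Set (Space n × Space n) // MeasurableSet S}

/-- The indicator function `χ(y, x)` of the unbroken bonds, when `S` is the set of broken ones. -/
def intact {n : ℕ} (S : BondSet n) (y x : Space n) : ℝ :=
  (S.1ᶜ).indicator (fun _ => (1 : ℝ)) (y, x)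

namespace Model

variable {n : ℕ} (M : Model n)

/-- The cracking body `D = Ω \ Ωd`. -/
def D : Set (Space n) := M.Ω \ M.Ωd

/-- Lebesgue measure on `Ω`. -/
def vol : Measure (Space n) := volume.restrict M.Ω

/-- `L^∞(Ω, ℝⁿ)`. -/
abbrev Linf : Type := Lp (Space n) ∞ M.vol

/-- `L²(Ω, ℝⁿ)`. -/
abbrev L2 : Type := Lp (Space n) 2 M.vol

/-- The space `𝒱` of displacements in `L^∞(Ω, ℝⁿ)` that vanish on `Ωd`. -/
def V : Submodule ℝ M.Linf where
  carrier := {v | ∀ᵐ x ∂M.vol, x ∈ M.Ωd → v x = 0}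
  zero_mem' := by
    filter_upwards [Lp.coeFn_zero (Space n) ∞ M.vol] with x hx _
    exact hx
  add_mem' := by
    intro a b ha hb
    filter_upwards [ha, hb, Lp.coeFn_add a b] with x h1 h2 h3 hx
    exact h3.trans (by simp [h1 hx, h2 hx])
  smul_mem' := by
    intro c a ha
    filter_upwards [ha, Lp.coeFn_smul c a] with x h1 h3 hx
    exact h3.trans (by simp [h1 hx])

/-- The space `ℬ` of boundary displacements in `L^∞(Ω, ℝⁿ)`, which vanish on `D`. -/
def B : Submodule ℝ M.Linf where
  carrier := {v | ∀ᵐ x ∂M.vol, x ∈ M.D → v x = 0}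
  zero_mem' := by
    filter_upwards [Lp.coeFn_zero (Space n) ∞ M.vol] with x hx _
    exact hx
  add_mem' := by
    intro a b ha hb
    filter_upwards [ha, hb, Lp.coeFn_add a b] with x h1 h2 h3 hx
    exact h3.trans (by simp [h1 hx, h2 hx])
  smul_mem' := by
    intro c a ha
    filter_upwards [ha, Lp.coeFn_smul c a] with x h1 h3 hx
    exact h3.trans (by simp [h1 hx])

/-- `J^ε(|y-x|) / (ε^{n+1} ω_n)`, with `ω_n` the volume of the unit ball. -/
def weight (y x : Space n) : ℝ :=
  M.J (‖y - x‖ / M.ε) / (M.ε ^ (n + 1) * volume.real (Metric.ball (0 : Space n) 1))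

/-- The integrand of the nonlocal force density. -/
def forceIntegrand (S : BondSet n) (u : Space n → Space n) (x y : Space n) : Space n :=
  (2 * intact S y x * M.weight y x / √‖y - x‖ *
    deriv M.g (√‖y - x‖ * strain y x u)) • bondDir y x

/-- The integrand of the linearization at `u` of the nonlocal force density, in direction `w`. -/
def linIntegrand (S : BondSet n) (u w : Space n → Space n) (x y : Space n) : Space n :=
  (2 * intact S y x * M.weight y x *
    iteratedDeriv 2 M.g (√‖y - x‖ * strain y x u) * strain y x w) • bondDir y x

/-- The nonlocal force density with broken bonds `S`, extended by zero outside `D`. -/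
def forceFun (S : BondSet n) (u : Space n → Space n) : Space n → Space n :=
  M.D.indicator fun x => -∫ y in Metric.ball x M.ε ∩ M.Ω, M.forceIntegrand S u x y

/-- The linearization at `u` of the nonlocal force density with broken bonds `S`, applied to `w`,
extended by zero outside `D`. -/
def linFun (S : BondSet n) (u w : Space n → Space n) : Space n → Space n :=
  M.D.indicator fun x => -∫ y in Metric.ball x M.ε ∩ M.Ω, M.linIntegrand S u w x y

/-- The stability tensor with broken bonds `S`. -/
def stabilityTensor (S : BondSet n) (u : Space n → Space n) (x : Space n) :
    Matrix (Fin n) (Fin n) ℝ :=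
  Matrix.of fun i j => ∫ y in Metric.ball x M.ε ∩ M.Ω,
    intact S y x * M.weight y x / ‖y - x‖ *
      iteratedDeriv 2 M.g (√‖y - x‖ * strain y x u) * (bondDir y x i * bondDir y x j)

/-- The condition `𝔸²[u] > γ² 𝕀` on `D`. -/
def StabilityAbove (S : BondSet n) (u : Space n → Space n) (γ : ℝ) : Prop :=
  ∀ᵐ x ∂M.vol, x ∈ M.D → ∀ v : Fin n → ℝ, v ≠ 0 →
    γ ^ 2 * (v ⬝ᵥ v) < ((M.stabilityTensor S u x * M.stabilityTensor S u x) *ᵥ v) ⬝ᵥ v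

/-- The closure of `𝒱` in `L²(Ω, ℝⁿ)`. -/
def VclosureL2 : Set M.L2 :=
  closure {w | ∃ v ∈ M.V, (w : Space n → Space n) =ᵐ[M.vol] (v : Space n → Space n)}

/-- The linearization at `u` has trivial kernel on the `L²`-closure of `𝒱`. -/
def TrivialKernelL2 (S : BondSet n) (u : Space n → Space n) : Prop :=
  ∀ w ∈ M.VclosureL2, M.linFun S u w =ᵐ[M.vol] 0 → w = 0

/-- The bonds `(y, x)`, `y ∈ Ω`, `x ∈ D`, `|y - x| < ε`, that are broken by the displacement `u`:
with `r = √|y-x| S(y, x, u)`, these are the ones with `g'(r) = 0` and `r < rₑ` or `r > r_c`. -/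
def brokenBy (u : Space n → Space n) : Set (Space n × Space n) :=
  {p | p.1 ∈ M.Ω ∧ p.2 ∈ M.D ∧ ‖p.1 - p.2‖ < M.ε ∧
    deriv M.g (√‖p.1 - p.2‖ * strain p.1 p.2 u) = 0 ∧
    (√‖p.1 - p.2‖ * strain p.1 p.2 u < M.re ∨ M.rc < √‖p.1 - p.2‖ * strain p.1 p.2 u)}

/-! Measurability and bounds, used to see that the operators act on `L^∞(Ω, ℝⁿ)`. -/

lemma measurable_dg : Measurable (deriv M.g) := by
  rw [← iteratedDeriv_one]
  exact (M.differentiable_g 1 (by norm_num)).continuous.measurable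

lemma measurable_ddg : Measurable (iteratedDeriv 2 M.g) :=
  (M.differentiable_g 2 (by norm_num)).continuous.measurable

lemma measurableSet_D : MeasurableSet M.D := M.isOpen_Ω.measurableSet.diff M.measurableSet_Ωd

lemma measurable_bondDir : Measurable fun p : Space n × Space n => bondDir p.1 p.2 := by
  unfold bondDir; fun_prop

lemma measurable_strain {u : Space n → Space n} (hu : Measurable u) :
    Measurable fun p : Space n × Space n => strain p.1 p.2 u := by
  have := measurable_bondDir (n := n)
  unfold strain; fun_prop

lemma measurable_intact (S : BondSet n) :
    Measurable fun p : Space n × Space n => intact S p.1 p.2 := by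
  unfold intact
  exact measurable_const.indicator S.2.compl

lemma measurable_weight : Measurable fun p : Space n × Space n => M.weight p.1 p.2 := by
  have := M.measurable_J
  unfold weight; fun_prop

lemma measurable_forceIntegrand (S : BondSet n) {u : Space n → Space n} (hu : Measurable u) :
    Measurable fun p : Space n × Space n => M.forceIntegrand S u p.2 p.1 := by
  have h1 := measurable_bondDir (n := n)
  have h2 := measurable_strain hu
  have h3 := measurable_intact S
  have h4 := M.measurable_weight
  have h5 := M.measurable_dg
  unfold forceIntegrand; fun_prop

lemma measurable_linIntegrand (S : BondSet n) {u w : Space n → Space n} (hu : Measurable u)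
    (hw : Measurable w) :
    Measurable fun p : Space n × Space n => M.linIntegrand S u w p.2 p.1 := by
  have h1 := measurable_bondDir (n := n)
  have h2 := measurable_strain hu
  have h2' := measurable_strain hw
  have h3 := measurable_intact S
  have h4 := M.measurable_weight
  have h5 := M.measurable_ddg
  unfold linIntegrand; fun_prop

lemma measurableSet_brokenBy {u : Space n → Space n} (hu : Measurable u) :
    MeasurableSet (M.brokenBy u) := by
  have h2 := measurable_strain hu
  have h5 := M.measurable_dg
  have hr : Measurable fun p : Space n × Space n => √‖p.1 - p.2‖ * strain p.1 p.2 u := by fun_prop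
  have hd : Measurable fun p : Space n × Space n => ‖p.1 - p.2‖ := by fun_prop
  refine (measurable_fst M.isOpen_Ω.measurableSet).inter <|
    (measurable_snd M.measurableSet_D).inter <|
    (measurableSet_lt hd measurable_const).inter <|
    ((h5.comp hr) (measurableSet_singleton 0)).inter <|
    (measurableSet_lt hr measurable_const).union (measurableSet_lt measurable_const hr)

lemma measurable_rep (u : M.Linf) : Measurable (u : Space n → Space n) :=
  (Lp.stronglyMeasurable u).measurable

lemma measurable_inner_integral {F : Space n → Space n → Space n}
    (hF : Measurable fun p : Space n × Space n => F p.2 p.1) :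
    StronglyMeasurable
      (M.D.indicator fun x => -∫ y in Metric.ball x M.ε ∩ M.Ω, F x y) := by
  refine StronglyMeasurable.indicator (StronglyMeasurable.neg ?_) M.measurableSet_D
  have hF' : Measurable fun p : Space n × Space n => F p.1 p.2 := hF.comp measurable_swap
  have hs : MeasurableSet {p : Space n × Space n | dist p.2 p.1 < M.ε} :=
    measurableSet_lt (by fun_prop) measurable_const
  have key : (fun x => ∫ y in Metric.ball x M.ε ∩ M.Ω, F x y) = fun x =>
      ∫ y in M.Ω, ({p : Space n × Space n | dist p.2 p.1 < M.ε}.indicator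
        (fun p => F p.1 p.2)) (x, y) := by
    funext x
    rw [inter_comm, ← setIntegral_indicator measurableSet_ball]
    rfl
  rw [key]
  exact (hF'.indicator hs).stronglyMeasurable.integral_prod_right'

lemma integrableOn_inv_norm_ball (x : Space n) :
    IntegrableOn (fun y => ‖y - x‖⁻¹) (Metric.ball x M.ε) := by
  have hn : 2 ≤ n := by rcases M.dim with h | h <;> omega
  have : Nonempty (Fin n) := ⟨⟨0, by omega⟩⟩
  have h0 : IntegrableOn (fun z : Space n => ‖z‖⁻¹) (Metric.ball 0 M.ε) := by
    rw [integrableOn_fun_norm_addHaar volume (f := fun r : ℝ => r⁻¹)]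
    refine Measure.integrableOn_of_bounded (M := M.ε ^ (n - 2)) (by simp) (by fun_prop) ?_
    refine (ae_restrict_iff' measurableSet_Ioo).2 (Eventually.of_forall fun r hr => ?_)
    have h1 : Module.finrank ℝ (Space n) - 1 = (n - 2) + 1 := by
      rw [finrank_euclideanSpace_fin]; omega
    rw [h1, pow_succ, smul_eq_mul, mul_assoc, mul_inv_cancel₀ hr.1.ne', mul_one, norm_pow,
      Real.norm_of_nonneg hr.1.le]
    exact pow_le_pow_left₀ hr.1.le hr.2.le _
  have := (measurePreserving_sub_right (volume : Measure (Space n)) x).integrableOn_comp_preimage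
    (MeasurableEquiv.subRight x).measurableEmbedding (f := fun z : Space n => ‖z‖⁻¹)
    (s := Metric.ball 0 M.ε)
  have h2 : (fun y : Space n => y - x) ⁻¹' Metric.ball 0 M.ε = Metric.ball x M.ε := by
    ext y; simp [dist_eq_norm]
  rw [h2] at this
  exact this.2 h0

lemma integrableOn_inv_norm (x : Space n) :
    IntegrableOn (fun y => ‖y - x‖⁻¹) (Metric.ball x M.ε ∩ M.Ω) :=
  (M.integrableOn_inv_norm_ball x).mono_set inter_subset_left

lemma exists_integral_inv_norm_le :
    ∃ C, 0 ≤ C ∧ ∀ x : Space n, ∫ y in Metric.ball x M.ε ∩ M.Ω, ‖y - x‖⁻¹ ≤ C := by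
  refine ⟨∫ z in Metric.ball (0 : Space n) M.ε, ‖z‖⁻¹, by positivity, fun x => ?_⟩
  rw [← (measurePreserving_sub_right (volume : Measure (Space n)) x).setIntegral_preimage_emb
    (MeasurableEquiv.subRight x).measurableEmbedding (fun z : Space n => ‖z‖⁻¹)]
  have h2 : (fun y : Space n => y - x) ⁻¹' Metric.ball 0 M.ε = Metric.ball x M.ε := by
    ext y; simp [dist_eq_norm]
  rw [h2]
  refine setIntegral_mono_set (M.integrableOn_inv_norm_ball x)
    (Eventually.of_forall fun y => by positivity) ?_
  exact Eventually.of_forall inter_subset_left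

lemma norm_bondDir_le (y x : Space n) : ‖bondDir y x‖ ≤ 1 := by
  rw [bondDir, norm_smul, norm_inv, norm_norm]
  exact inv_mul_le_one

lemma abs_strain_le (y x : Space n) (u : Space n → Space n) :
    |strain y x u| ≤ ‖u y - u x‖ * ‖y - x‖⁻¹ := by
  refine (abs_real_inner_le_norm _ _).trans ?_
  rw [norm_smul, norm_inv, norm_norm]
  calc ‖y - x‖⁻¹ * ‖u y - u x‖ * ‖bondDir y x‖ ≤ ‖y - x‖⁻¹ * ‖u y - u x‖ * 1 := by
        gcongr; exact norm_bondDir_le y x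
    _ = _ := by ring

lemma abs_intact_le (S : BondSet n) (y x : Space n) : |intact S y x| ≤ 1 := by
  unfold intact
  by_cases h : (y, x) ∈ S.1 <;> simp [h]

lemma exists_weight_le : ∃ C, 0 ≤ C ∧ ∀ y x, |M.weight y x| ≤ C := by
  obtain ⟨K, hK⟩ := M.J_bounded
  have hc : 0 ≤ M.ε ^ (n + 1) * volume.real (Metric.ball (0 : Space n) 1) := by
    have := M.ε_pos
    positivity
  refine ⟨K / (M.ε ^ (n + 1) * volume.real (Metric.ball (0 : Space n) 1)),
    div_nonneg ((M.J_nonneg 0).trans (hK 0)) hc, fun y x => ?_⟩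
  rw [weight, abs_of_nonneg (div_nonneg (M.J_nonneg _) hc)]
  exact div_le_div_of_nonneg_right (hK _) hc

lemma exists_forceIntegrand_le (S : BondSet n) : ∃ C, 0 ≤ C ∧ ∀ u (x y : Space n),
    y ∈ Metric.ball x M.ε → ‖M.forceIntegrand S u x y‖ ≤ C * ‖y - x‖⁻¹ := by
  obtain ⟨W, hW0, hW⟩ := M.exists_weight_le
  obtain ⟨G, hG⟩ := M.bounded_g 1 (by norm_num)
  rw [iteratedDeriv_one] at hG
  have hG0 : 0 ≤ G := (abs_nonneg _).trans (hG 0)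
  refine ⟨2 * 1 * W * √M.ε * G, by positivity, fun u x y hy => ?_⟩
  have hd : ‖y - x‖ ≤ M.ε := by rw [← dist_eq_norm]; exact hy.le
  have hs : (√‖y - x‖)⁻¹ ≤ √M.ε * ‖y - x‖⁻¹ := by
    rcases eq_or_lt_of_le (norm_nonneg (y - x)) with h | h
    · simp [← h]
    · have h1 : 0 < √‖y - x‖ := Real.sqrt_pos.2 h
      have h2 : ‖y - x‖⁻¹ = (√‖y - x‖)⁻¹ * (√‖y - x‖)⁻¹ := by
        rw [← mul_inv, Real.mul_self_sqrt h.le]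
      rw [h2, ← mul_assoc]
      refine le_mul_of_one_le_left (by positivity) ?_
      rw [← div_eq_mul_inv, one_le_div h1]
      exact Real.sqrt_le_sqrt hd
  rw [forceIntegrand, norm_smul, Real.norm_eq_abs, abs_mul, abs_div, abs_mul, abs_mul,
    abs_of_nonneg (Real.sqrt_nonneg _), abs_two, div_eq_mul_inv]
  calc _ ≤ 2 * 1 * W * (√M.ε * ‖y - x‖⁻¹) * G * 1 := by
        gcongr
        · exact abs_intact_le S y x
        · exact hW y x
        · exact hG _
        · exact norm_bondDir_le y x
    _ = _ := by ring

lemma exists_linIntegrand_le (S : BondSet n) : ∃ C, 0 ≤ C ∧ ∀ u w (x y : Space n),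
    ‖M.linIntegrand S u w x y‖ ≤ C * ‖w y - w x‖ * ‖y - x‖⁻¹ := by
  obtain ⟨W, hW0, hW⟩ := M.exists_weight_le
  obtain ⟨G, hG⟩ := M.bounded_g 2 (by norm_num)
  have hG0 : 0 ≤ G := (abs_nonneg _).trans (hG 0)
  refine ⟨2 * 1 * W * G, by positivity, fun u w x y => ?_⟩
  rw [linIntegrand, norm_smul, Real.norm_eq_abs, abs_mul, abs_mul, abs_mul, abs_mul, abs_two]
  calc _ ≤ 2 * 1 * W * G * (‖w y - w x‖ * ‖y - x‖⁻¹) * 1 := by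
        gcongr
        · exact abs_intact_le S y x
        · exact hW y x
        · exact hG _
        · exact abs_strain_le y x w
        · exact norm_bondDir_le y x
    _ = _ := by ring

lemma ae_norm_le (w : M.Linf) : ∀ᵐ x ∂M.vol, ‖w x‖ ≤ ‖w‖ := by
  filter_upwards [ae_le_eLpNormEssSup (f := (w : Space n → Space n)) (μ := M.vol)] with x hx
  rw [Lp.norm_def, eLpNorm_exponent_top, ← toReal_enorm (w x)]
  refine ENNReal.toReal_mono ?_ hx
  rw [← eLpNorm_exponent_top]
  exact (Lp.eLpNorm_lt_top w).ne

lemma ae_near {p : Space n → Prop} (hp : ∀ᵐ y ∂M.vol, p y) (x : Space n) :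
    ∀ᵐ y ∂volume.restrict (Metric.ball x M.ε ∩ M.Ω), p y :=
  ae_mono (Measure.restrict_mono inter_subset_right le_rfl) hp

lemma exists_linIntegrand_ae_le (S : BondSet n) : ∃ C, 0 ≤ C ∧ ∀ u (w : M.Linf), ∀ᵐ x ∂M.vol,
    ∀ᵐ y ∂volume.restrict (Metric.ball x M.ε ∩ M.Ω),
      ‖M.linIntegrand S u w x y‖ ≤ C * ‖w‖ * ‖y - x‖⁻¹ := by
  obtain ⟨C, hC0, hC⟩ := M.exists_linIntegrand_le S
  refine ⟨C * 2, by positivity, fun u w => ?_⟩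
  filter_upwards [M.ae_norm_le w] with x hx
  filter_upwards [M.ae_near (M.ae_norm_le w) x] with y hy
  refine (hC u w x y).trans ?_
  have : ‖w y - w x‖ ≤ 2 * ‖w‖ := (norm_sub_le _ _).trans (by linarith)
  calc C * ‖w y - w x‖ * ‖y - x‖⁻¹ ≤ C * (2 * ‖w‖) * ‖y - x‖⁻¹ := by gcongr
    _ = _ := by ring

lemma norm_indicator_neg_integral_le {F : Space n → Space n → Space n} {x : Space n} {A C : ℝ}
    (hA : 0 ≤ A) (hC : ∫ y in Metric.ball x M.ε ∩ M.Ω, ‖y - x‖⁻¹ ≤ C)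
    (hF : ∀ᵐ y ∂volume.restrict (Metric.ball x M.ε ∩ M.Ω), ‖F x y‖ ≤ A * ‖y - x‖⁻¹) :
    ‖M.D.indicator (fun x => -∫ y in Metric.ball x M.ε ∩ M.Ω, F x y) x‖ ≤ A * C := by
  refine (norm_indicator_le_norm_self _ _).trans ?_
  rw [norm_neg]
  refine (norm_integral_le_of_norm_le ((M.integrableOn_inv_norm x).const_mul A) hF).trans ?_
  rw [integral_const_mul]
  gcongr

lemma memLp_forceFun (S : BondSet n) (u : M.Linf) : MemLp (M.forceFun S u) ∞ M.vol := by
  obtain ⟨A, hA0, hA⟩ := M.exists_forceIntegrand_le S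
  obtain ⟨C, -, hC⟩ := M.exists_integral_inv_norm_le
  refine memLp_top_of_bound (M.measurable_inner_integral
    (M.measurable_forceIntegrand S (M.measurable_rep u))).aestronglyMeasurable (A * C) ?_
  refine Eventually.of_forall fun x => M.norm_indicator_neg_integral_le hA0 (hC x) ?_
  exact (ae_restrict_iff' (measurableSet_ball.inter M.isOpen_Ω.measurableSet)).2
    (Eventually.of_forall fun y hy => hA u x y hy.1)

lemma exists_linFun_le (S : BondSet n) : ∃ C, 0 ≤ C ∧ ∀ u (w : M.Linf), ∀ᵐ x ∂M.vol,
    ‖M.linFun S u w x‖ ≤ C * ‖w‖ := by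
  obtain ⟨A, hA0, hA⟩ := M.exists_linIntegrand_ae_le S
  obtain ⟨C, hC0, hC⟩ := M.exists_integral_inv_norm_le
  refine ⟨A * C, by positivity, fun u w => ?_⟩
  filter_upwards [hA u w] with x hx
  refine (M.norm_indicator_neg_integral_le (F := M.linIntegrand S u w)
    (A := A * ‖w‖) (by positivity) (hC x) hx).trans (le_of_eq (by ring))

lemma memLp_linFun (S : BondSet n) (u w : M.Linf) : MemLp (M.linFun S u w) ∞ M.vol := by
  obtain ⟨C, -, hC⟩ := M.exists_linFun_le S
  exact memLp_top_of_bound (M.measurable_inner_integral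
    (M.measurable_linIntegrand S (M.measurable_rep u) (M.measurable_rep w))).aestronglyMeasurable
    (C * ‖w‖) (hC u w)

lemma integrable_linIntegrand (S : BondSet n) (u w : M.Linf) : ∀ᵐ x ∂M.vol,
    IntegrableOn (M.linIntegrand S u w x) (Metric.ball x M.ε ∩ M.Ω) := by
  obtain ⟨A, -, hA⟩ := M.exists_linIntegrand_ae_le S
  filter_upwards [hA u w] with x hx
  refine Integrable.mono' ((M.integrableOn_inv_norm x).const_mul (A * ‖w‖)) ?_ hx
  exact ((M.measurable_linIntegrand S (M.measurable_rep u) (M.measurable_rep w)).comp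
    (measurable_id.prodMk measurable_const)).aestronglyMeasurable

lemma strain_add (y x : Space n) (v w : Space n → Space n) :
    strain y x (fun z => v z + w z) = strain y x v + strain y x w := by
  simp only [strain]
  rw [← inner_add_left, ← smul_add]
  congr 2
  abel

lemma strain_smul (y x : Space n) (c : ℝ) (v : Space n → Space n) :
    strain y x (fun z => c • v z) = c * strain y x v := by
  simp only [strain]
  rw [← smul_sub, smul_comm, real_inner_smul_left]

lemma strain_congr {y x : Space n} {v w : Space n → Space n} (hy : v y = w y) (hx : v x = w x) :
    strain y x v = strain y x w := by
  simp only [strain, hy, hx]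

lemma linFun_add (S : BondSet n) (u v w : M.Linf) :
    M.linFun S u (v + w : M.Linf) =ᵐ[M.vol] M.linFun S u v + M.linFun S u w := by
  filter_upwards [Lp.coeFn_add v w, M.integrable_linIntegrand S u v,
    M.integrable_linIntegrand S u w] with x hx hv hw
  by_cases hD : x ∈ M.D
  · simp only [linFun, Pi.add_apply, indicator_of_mem hD]
    rw [← neg_add, ← integral_add hv hw]
    congr 1
    refine integral_congr_ae ?_
    filter_upwards [M.ae_near (Lp.coeFn_add v w) x] with y hy
    have : strain y x (v + w : M.Linf) = strain y x v + strain y x w := by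
      rw [← strain_add]; exact strain_congr hy hx
    simp only [linIntegrand, this, mul_add, add_smul]
  · simp [linFun, hD]

lemma linFun_smul (S : BondSet n) (u : M.Linf) (c : ℝ) (v : M.Linf) :
    M.linFun S u (c • v : M.Linf) =ᵐ[M.vol] c • M.linFun S u v := by
  filter_upwards [Lp.coeFn_smul c v] with x hx
  by_cases hD : x ∈ M.D
  · simp only [linFun, Pi.smul_apply, indicator_of_mem hD]
    rw [smul_neg, ← integral_smul]
    congr 1
    refine integral_congr_ae ?_
    filter_upwards [M.ae_near (Lp.coeFn_smul c v) x] with y hy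
    have : strain y x (c • v : M.Linf) = c * strain y x v := by
      rw [← strain_smul]; exact strain_congr hy hx
    simp only [linIntegrand, this, smul_smul]
    congr 1
    ring
  · simp [linFun, hD]

lemma toLp_mem_V {F : Space n → Space n} (h : MemLp (M.D.indicator F) ∞ M.vol) :
    h.toLp _ ∈ M.V := by
  change ∀ᵐ x ∂M.vol, x ∈ M.Ωd → _
  filter_upwards [h.coeFn_toLp] with x hx hxd
  rw [hx, indicator_of_notMem fun hD => hD.2 hxd]

/-- The nonlocal force operator `ℒ` with broken bonds `S`, from `L^∞(Ω, ℝⁿ)` to `𝒱`. -/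
def force (S : BondSet n) (u : M.Linf) : M.V :=
  ⟨(M.memLp_forceFun S u).toLp _, M.toLp_mem_V (M.memLp_forceFun S u)⟩

/-- The linearization `ℒ'[u]` of the nonlocal force operator with broken bonds `S`, as a bounded
linear operator on `𝒱`. -/
def lin (S : BondSet n) (u : M.Linf) : M.V →L[ℝ] M.V :=
  LinearMap.mkContinuousOfExistsBound
    { toFun := fun w => ⟨(M.memLp_linFun S u w).toLp _, M.toLp_mem_V (M.memLp_linFun S u w)⟩
      map_add' := fun v w => Subtype.ext <| by
        refine Lp.ext ((MemLp.coeFn_toLp (M.memLp_linFun S u (v + w : M.V))).trans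
          ((M.linFun_add S u v w).trans ?_))
        refine EventuallyEq.trans ?_ (Lp.coeFn_add _ _).symm
        exact (MemLp.coeFn_toLp (M.memLp_linFun S u v)).symm.add
          (MemLp.coeFn_toLp (M.memLp_linFun S u w)).symm
      map_smul' := fun c v => Subtype.ext <| by
        refine Lp.ext ((MemLp.coeFn_toLp (M.memLp_linFun S u (c • v : M.V))).trans
          ((M.linFun_smul S u c v).trans ?_))
        refine EventuallyEq.trans ?_ (Lp.coeFn_smul _ _).symm
        exact (MemLp.coeFn_toLp (M.memLp_linFun S u v)).symm.const_smul c } <| by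
    obtain ⟨C, hC0, hC⟩ := M.exists_linFun_le S
    refine ⟨C, fun w => ?_⟩
    change ‖(M.memLp_linFun S u w).toLp _‖ ≤ C * ‖(w : M.Linf)‖
    rw [Lp.norm_toLp, eLpNorm_exponent_top]
    exact ENNReal.toReal_le_of_le_ofReal (by positivity) (eLpNormEssSup_le_of_ae_bound (hC u w))

/-- The set of broken bonds after breaking, in addition to those of `S`, the bonds that are broken
by `u`. -/
def breakBonds (S : BondSet n) (u : M.Linf) : BondSet n :=
  ⟨S.1 ∪ M.brokenBy u, S.2.union (M.measurableSet_brokenBy (M.measurable_rep u))⟩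

/-- The set `S_N` of bonds broken in the first `N` load steps, which have displacements
`u 1, …, u N`; initially, all bonds are intact. -/
def brokenBonds (u : ℕ → M.Linf) : ℕ → BondSet n
  | 0 => ⟨∅, MeasurableSet.empty⟩
  | N + 1 => M.breakBonds (brokenBonds u N) (u (N + 1))

/-- The Newton map `T(v) = v - ℒ'[v + U]⁻¹ ℒ[v + U]` on `𝒱`. It is meaningful at those `v` for which
`ℒ'[v + U]` is boundedly invertible. -/
def newtonMap (S : BondSet n) (U : M.B) (v : M.V) : M.V :=
  v - (M.lin S (v + U)).inverse (M.force S (v + U))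

end Model

end Peridynamics

end

/-!
The result combines Newton's method in the Banach space `𝒱` with a Fredholm alternative for the
linearized force operator.

**Newton's method.** For fixed boundary values `U`, the map `v ↦ ℒ[v + U]` on `𝒱` has the Fréchet
derivative `ℒ'[v + U]` (`Peridynamics.Model.hasFDerivAt_force`). The remainder of the first order
expansion, like the difference `ℒ'[w] - ℒ'[w']`, is an integral over bonds with a singularity
`|y - x|^{-3/2}`, which is integrable in dimensions two and three. The solution at the next load
step is the fixed point of the simplified Newton map `v ↦ v - ℒ'[u₀]⁻¹ ℒ[v + U]`, which contracts
the closed ball of radius `t₁`. Its Lipschitz constant between points of the `t₁`- and the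
`t₂`-ball is at most `‖ℒ'[u₀]⁻¹‖ K (t₁ + t₂) / 2 = ‖ℒ'[u₀]⁻¹‖ / β < 1`, and this gives uniqueness in
the closed `t₂`-ball (`NewtonKantorovich.exists_zero`). The Newton map itself preserves the
`t₁`-ball if the first step is at most `t₁ - 3/2 β K t₁²`, which is positive exactly if `h < 4/9`.
This bound is smaller than `η`, but since `ℒ[uᴺ] = 0` and `ℒ` is Lipschitz in `U`, the first step is
as small as desired when `δ` is small.

**Invertibility of `ℒ'[uᴺ]`.** On `D` the linearization is `2 𝔸(x) w(x)` minus an integral operator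
whose kernel is bounded by a multiple of `1/|y - x|` (`Peridynamics.Model.ae_linFun_indicator_eq`).
The stability condition bounds `𝔸(x)⁻¹` by `1/γ`, so that `ℒ'[uᴺ] w = f` becomes an equation of
the second kind. An operator on `L^∞` with such a kernel need not be compact, so the Fredholm
alternative is applied in `L²(D)`. The kernel is split into the part of short bonds, which by
Schur's test has norm at most `1/2` on `L²`, and a bounded part, which is Hilbert–Schmidt and hence
compact. The trivial null space of `ℒ'[uᴺ]` gives a solution `w` in `L²`. It is bounded, since it is the fixed
point of a contraction `v ↦ g + T₁ v` with bounded `g`, where `T₁` is also a contraction in the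
supremum norm (`IntegralOperator.exists_memLp_top_eq_add_apply`).

**New broken bonds.** A bond broken by `u` satisfies `g' = 0` at `u`, so breaking it leaves the
force at `u` unchanged (`Peridynamics.Model.force_breakBonds`).
-/

noncomputable section

/-! ### Newton's method for maps with Lipschitz continuous derivative -/

namespace NewtonKantorovich

variable {X : Type*} [NormedAddCommGroup X] [NormedSpace ℝ X]

/-- The quadratic error bound for a map with `K`-Lipschitz derivative. The base point `a` of the
linearization need not lie on the segment from `w` to `v`: `a = w` gives the usual Taylor
estimate, `a ≠ w` the estimate used for uniqueness. -/
lemma norm_sub_sub_le {F : X → X} {F' : X → X →L[ℝ] X} {K : ℝ}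
    (hF : ∀ x, HasFDerivAt F (F' x) x) (hK0 : 0 ≤ K)
    (hK : ∀ x y, ‖F' x - F' y‖ ≤ K * ‖x - y‖) (a v w : X) :
    ‖F v - F w - F' a (v - w)‖ ≤ K / 2 * (‖v - a‖ + ‖w - a‖) * ‖v - w‖ := by
  set γ : ℝ → X := fun θ => w + θ • (v - w) with hγ
  have hγd : ∀ θ, HasDerivAt γ (v - w) θ := fun θ => by
    simpa only [one_smul] using ((hasDerivAt_id' θ).smul_const (v - w)).const_add w
  have hd : ∀ θ, HasDerivAt (fun θ => F (γ θ) - F w - θ • F' a (v - w))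
      (F' (γ θ) (v - w) - F' a (v - w)) θ := fun θ => by
    have h1 := (hF (γ θ)).comp_hasDerivAt θ (hγd θ)
    have h2 : HasDerivAt (fun θ : ℝ => θ • F' a (v - w)) (F' a (v - w)) θ := by
      simpa using (hasDerivAt_id θ).smul_const (F' a (v - w))
    exact (h1.sub_const (F w)).sub h2
  have hB : ∀ θ : ℝ, HasDerivAt
      (fun θ : ℝ => K * ((θ - θ ^ 2 / 2) * ‖w - a‖ + θ ^ 2 / 2 * ‖v - a‖) * ‖v - w‖)
      (K * ((1 - θ) * ‖w - a‖ + θ * ‖v - a‖) * ‖v - w‖) θ := fun θ => by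
    have h2 : HasDerivAt (fun θ : ℝ => θ ^ 2 / 2) θ θ := by
      have := (hasDerivAt_pow 2 θ).div_const 2
      simpa using this
    exact (((((hasDerivAt_id θ).sub h2).mul_const _).add (h2.mul_const _)).const_mul K).mul_const _
  have hb : ∀ θ ∈ Ico (0 : ℝ) 1, ‖F' (γ θ) (v - w) - F' a (v - w)‖ ≤
      K * ((1 - θ) * ‖w - a‖ + θ * ‖v - a‖) * ‖v - w‖ := fun θ hθ => by
    have h1 : ‖γ θ - a‖ ≤ (1 - θ) * ‖w - a‖ + θ * ‖v - a‖ := by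
      have : γ θ - a = (1 - θ) • (w - a) + θ • (v - a) := by simp only [hγ]; module
      rw [this]
      refine (norm_add_le _ _).trans (le_of_eq ?_)
      rw [norm_smul, norm_smul, Real.norm_of_nonneg (by linarith [hθ.2]),
        Real.norm_of_nonneg hθ.1]
    rw [← sub_apply]
    refine ((F' (γ θ) - F' a).le_opNorm _).trans ?_
    gcongr
    exact (hK _ _).trans (by gcongr)
  have := image_norm_le_of_norm_deriv_right_le_deriv_boundary
    (fun θ _ => (hd θ).continuousAt.continuousWithinAt)
    (fun θ _ => (hd θ).hasDerivWithinAt) (by simp [hγ]) hB hb (right_mem_Icc.2 zero_le_one)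
  refine (le_of_eq ?_).trans (this.trans (le_of_eq ?_))
  · simp [hγ]
  · ring

/-- Stability of invertibility, with the Neumann series bound for the inverse. The bound is stated
without dividing by `1 - b * d`. -/
lemma isInvertible_of_norm_sub_le [CompleteSpace X] {A B : X →L[ℝ] X} (hA : A.IsInvertible)
    {b d : ℝ} (hb : ‖A.inverse‖ ≤ b) (hd : ‖B - A‖ ≤ d) (hbd : b * d < 1) :
    B.IsInvertible ∧ ∀ y, (1 - b * d) * ‖B.inverse y‖ ≤ ‖A.inverse y‖ := by
  have hb0 : 0 ≤ b := (norm_nonneg _).trans hb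
  have h1 : ‖A.inverse ∘L (A - B)‖ ≤ b * d := by
    refine (ContinuousLinearMap.opNorm_comp_le _ _).trans ?_
    rw [norm_sub_rev]
    gcongr
  have hu : IsUnit (1 - A.inverse ∘L (A - B)) := isUnit_one_sub_of_norm_lt_one (h1.trans_lt hbd)
  have hB : B = A ∘L (1 - A.inverse ∘L (A - B)) := by
    ext x
    simp [hA.self_apply_inverse]
  have hBi : B.IsInvertible := by
    rw [hB]
    refine hA.comp ?_
    obtain ⟨u, hu⟩ := hu
    exact ⟨ContinuousLinearEquiv.ofUnit u, by rw [← hu]; rfl⟩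
  refine ⟨hBi, fun y => ?_⟩
  have h2 : B.inverse y = A.inverse y + (A.inverse ∘L (A - B)) (B.inverse y) := by
    simp [hA.inverse_apply_self, hBi.self_apply_inverse]
  have h3 := ((A.inverse ∘L (A - B)).le_of_opNorm_le h1 (B.inverse y))
  have h4 := norm_add_le (A.inverse y) ((A.inverse ∘L (A - B)) (B.inverse y))
  rw [← h2] at h4
  linarith

section

variable {F : X → X} {F' : X → X →L[ℝ] X} {K β t₁ t₂ : ℝ} {v₀ : X}

/-- The derivative stays invertible on the ball of radius `t₁ < 1 / (β K)`. -/
lemma isInvertible_of_mem_closedBall [CompleteSpace X]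
    (hK : ∀ x y, ‖F' x - F' y‖ ≤ K * ‖x - y‖) (hK0 : 0 < K)
    (hinv : (F' v₀).IsInvertible) (hβ : ‖(F' v₀).inverse‖ < β) (ht : β * K * t₁ < 1)
    {v : X} (hv : v ∈ Metric.closedBall v₀ t₁) :
    (F' v).IsInvertible ∧
      ∀ y, (1 - β * K * t₁) * ‖(F' v).inverse y‖ ≤ ‖(F' v₀).inverse y‖ := by
  rw [mul_assoc] at ht ⊢
  refine isInvertible_of_norm_sub_le hinv hβ.le ((hK v v₀).trans ?_) ht
  rw [mem_closedBall_iff_norm] at hv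
  gcongr

/-- The Newton map preserves the ball of radius `t₁` as soon as the first Newton step is at most
`t₁ - 3/2 β K t₁²`. This quantity is positive exactly if `t₁ < 2 / (3 β K)`. -/
lemma mapsTo_newton [CompleteSpace X]
    (hF : ∀ x, HasFDerivAt F (F' x) x) (hK : ∀ x y, ‖F' x - F' y‖ ≤ K * ‖x - y‖) (hK0 : 0 < K)
    (hinv : (F' v₀).IsInvertible) (hβ : ‖(F' v₀).inverse‖ < β) (ht : β * K * t₁ < 1)
    (hη : ‖(F' v₀).inverse (F v₀)‖ ≤ t₁ - 3 / 2 * (β * K * t₁ ^ 2)) :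
    MapsTo (fun v => v - (F' v).inverse (F v)) (Metric.closedBall v₀ t₁)
      (Metric.closedBall v₀ t₁) := by
  intro v hv
  obtain ⟨hi, hle⟩ := isInvertible_of_mem_closedBall hK hK0 hinv hβ ht hv
  rw [mem_closedBall_iff_norm] at hv ⊢
  have ht0 : 0 ≤ t₁ := (norm_nonneg _).trans hv
  set R := F v₀ - F v - F' v (v₀ - v) with hR
  have hRle : ‖R‖ ≤ K / 2 * t₁ ^ 2 := by
    have := norm_sub_sub_le hF hK0.le hK v v₀ v
    rw [sub_self, norm_zero, add_zero, norm_sub_rev v₀ v, mul_assoc] at this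
    refine this.trans ?_
    rw [sq]
    gcongr
  have h1 : v - (F' v).inverse (F v) - v₀ = (F' v).inverse (R - F v₀) := by
    have : R - F v₀ = F' v (v - v₀) - F v := by
      rw [hR, ← neg_sub v v₀, map_neg]; abel
    rw [this, map_sub, hi.inverse_apply_self]
    abel
  have h2 := hle (R - F v₀)
  have h3 : ‖(F' v₀).inverse (R - F v₀)‖ ≤ β * (K / 2 * t₁ ^ 2) +
      (t₁ - 3 / 2 * (β * K * t₁ ^ 2)) := by
    rw [map_sub]
    refine (norm_sub_le _ _).trans (add_le_add ?_ hη)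
    have := (F' v₀).inverse.le_of_opNorm_le hβ.le R
    have hβ0 : 0 ≤ β := (norm_nonneg _).trans hβ.le
    exact this.trans (by gcongr)
  rw [h1]
  have h4 : 0 < 1 - β * K * t₁ := by linarith
  refine le_of_mul_le_mul_left ?_ h4
  linarith

/-- Existence of a zero in the ball of radius `t₁`, and its uniqueness in the closed ball of radius
`t₂`, by means of the simplified Newton map `v ↦ v - F'(v₀)⁻¹ F(v)`. -/
lemma exists_zero [CompleteSpace X]
    (hF : ∀ x, HasFDerivAt F (F' x) x) (hK : ∀ x y, ‖F' x - F' y‖ ≤ K * ‖x - y‖) (hK0 : 0 < K)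
    (hinv : (F' v₀).IsInvertible) (hβ : ‖(F' v₀).inverse‖ < β) (ht0 : 0 ≤ t₁)
    (ht : β * K * t₁ < 1) (ht₂ : β * K * (t₁ + t₂) = 2)
    (hη : ‖(F' v₀).inverse (F v₀)‖ ≤ t₁ - β * K * t₁ ^ 2 / 2) :
    ∃ v' ∈ Metric.closedBall v₀ t₁, F v' = 0 ∧
      ∀ v ∈ Metric.closedBall v₀ t₂, F v = 0 → v = v' := by
  have hβ0 : 0 < β := (norm_nonneg _).trans_lt hβ
  set Φ : X → X := fun v => v - (F' v₀).inverse (F v) with hΦ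
  have hsub : ∀ v w, Φ v - Φ w = -(F' v₀).inverse (F v - F w - F' v₀ (v - w)) := fun v w => by
    simp only [hΦ, map_sub, hinv.inverse_apply_self]
    abel
  have hlip : ∀ v w, ‖Φ v - Φ w‖ ≤
      ‖(F' v₀).inverse‖ * (K / 2 * (‖v - v₀‖ + ‖w - v₀‖)) * ‖v - w‖ := fun v w => by
    rw [hsub, norm_neg, mul_assoc]
    refine ((F' v₀).inverse.le_opNorm _).trans ?_
    gcongr
    exact norm_sub_sub_le hF hK0.le hK v₀ v w
  have hmaps : MapsTo Φ (Metric.closedBall v₀ t₁) (Metric.closedBall v₀ t₁) := fun v hv => by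
    rw [mem_closedBall_iff_norm] at hv ⊢
    have h1 := hlip v v₀
    rw [sub_self, norm_zero, add_zero] at h1
    have h2 : ‖Φ v₀ - v₀‖ ≤ t₁ - β * K * t₁ ^ 2 / 2 := by
      simpa [hΦ] using hη
    have h3 : ‖(F' v₀).inverse‖ * (K / 2 * ‖v - v₀‖) * ‖v - v₀‖ ≤ β * (K / 2 * t₁) * t₁ := by
      gcongr
    have h4 := norm_add_le (Φ v - Φ v₀) (Φ v₀ - v₀)
    rw [sub_add_sub_cancel] at h4
    nlinarith
  have hcontr : ContractingWith (β * K * t₁).toNNReal (hmaps.restrict Φ _ _) := by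
    refine ⟨by simpa [Real.toNNReal_lt_one] using ht, LipschitzWith.of_dist_le_mul ?_⟩
    rintro ⟨v, hv⟩ ⟨w, hw⟩
    rw [Real.coe_toNNReal _ (by positivity)]
    change dist (Φ v) (Φ w) ≤ _ * dist v w
    rw [dist_eq_norm, dist_eq_norm]
    rw [mem_closedBall_iff_norm] at hv hw
    refine (hlip v w).trans ?_
    have : β * K * t₁ = β * (K / 2 * (t₁ + t₁)) := by ring
    rw [this]
    gcongr
  obtain ⟨v', hv', hfix, -⟩ := hcontr.exists_fixedPoint' Metric.isClosed_closedBall.isComplete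
    hmaps (Metric.mem_closedBall_self ht0) (edist_ne_top _ _)
  have hFv' : F v' = 0 := by
    have h1 : (F' v₀).inverse (F v') = 0 := by
      have : v' - (F' v₀).inverse (F v') = v' := hfix
      simpa using this
    rw [← hinv.self_apply_inverse (F v'), h1, map_zero]
  refine ⟨v', hv', hFv', fun v hv hFv => ?_⟩
  by_contra hne
  have h1 := hlip v v'
  have h2 : Φ v - Φ v' = v - v' := by simp [hΦ, hFv, hFv']
  rw [h2] at h1
  have hpos : 0 < ‖v - v'‖ := norm_pos_iff.2 (sub_ne_zero.2 hne)
  rw [mem_closedBall_iff_norm] at hv hv'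
  -- the Lipschitz constant of `Φ` between the two balls is `‖F'(v₀)⁻¹‖ / β < 1`
  have ht12 : 0 < t₁ + t₂ := by
    by_contra hcon
    have := mul_nonpos_of_nonneg_of_nonpos (mul_pos hβ0 hK0).le (not_lt.1 hcon)
    linarith
  have h3 : ‖(F' v₀).inverse‖ * (K / 2 * (‖v - v₀‖ + ‖v' - v₀‖)) < 1 := by
    calc _ ≤ ‖(F' v₀).inverse‖ * (K / 2 * (t₁ + t₂)) := by
          rw [add_comm t₁]; gcongr
      _ < β * (K / 2 * (t₁ + t₂)) := by gcongr
      _ = 1 := by linarith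
  nlinarith

end

end NewtonKantorovich

/-! ### Hilbert–Schmidt operators -/

/-- A bounded operator on a Hilbert space is compact if `∑ ‖T e‖²` is bounded over all finite
orthonormal families, that is, if `T` is Hilbert–Schmidt. -/
theorem isCompactOperator_of_sum_norm_sq_le {H H' : Type*} [NormedAddCommGroup H]
    [InnerProductSpace ℝ H] [NormedAddCommGroup H'] [NormedSpace ℝ H'] [CompleteSpace H']
    (T : H →L[ℝ] H') (C : ℝ)
    (h : ∀ s : Finset H, Orthonormal ℝ ((↑) : s → H) → ∑ e ∈ s, ‖T e‖ ^ 2 ≤ C) :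
    IsCompactOperator T := by
  classical
  set A : Set ℝ := {a | ∃ s : Finset H, Orthonormal ℝ ((↑) : s → H) ∧ ∑ e ∈ s, ‖T e‖ ^ 2 = a}
    with hA
  have hne : A.Nonempty :=
    ⟨0, ∅, ⟨fun i => absurd i.2 (Finset.notMem_empty _),
      fun i => absurd i.2 (Finset.notMem_empty _)⟩, rfl⟩
  have hbdd : BddAbove A := ⟨C, by rintro _ ⟨s, hs, rfl⟩; exact h s hs⟩
  refine (isClosed_setOfPred_isCompactOperator (σ₁₂ := RingHom.id ℝ)
    (M₁ := H) (M₂ := H')).closure_subset (Metric.mem_closure_iff.2 fun ε hε => ?_)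
  obtain ⟨_, ⟨s, hs, rfl⟩, hlt⟩ := exists_lt_of_lt_csSup hne
    (sub_lt_self (sSup A) (show 0 < (ε / 2) ^ 2 by positivity))
  have hunit : ∀ u : H, ‖u‖ = 1 → (∀ e ∈ s, inner ℝ e u = 0) → ‖T u‖ ≤ ε / 2 := by
    intro u hu hperp
    have hus : u ∉ s := fun hmem => by
      have := hperp u hmem
      rw [real_inner_self_eq_norm_sq, hu] at this
      norm_num at this
    have hins : Orthonormal ℝ (Subtype.val : {x // x ∈ insert u s} → H) := by
      have hs' := (orthonormal_subtype_iff_ite (𝕜 := ℝ) (s := (s : Set H))).1 hs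
      refine (orthonormal_subtype_iff_ite (𝕜 := ℝ) (s := ((insert u s : Finset H) : Set H))).2 ?_
      intro v hv w hw
      rw [Finset.mem_coe, Finset.mem_insert] at hv hw
      rcases hv with hv | hv <;> rcases hw with hw | hw
      · simp [hv, hw, hu]
      · rw [hv, if_neg (fun huw : u = w => hus (huw ▸ hw)), real_inner_comm, hperp w hw]
      · rw [hw, if_neg (fun hvu : v = u => hus (hvu ▸ hv)), hperp v hv]
      · exact hs' v hv w hw
    have h1 := le_csSup hbdd ⟨_, hins, rfl⟩
    rw [Finset.sum_insert hus] at h1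
    exact le_of_sq_le_sq (by linarith) (by positivity)
  set W : Submodule ℝ H := Submodule.span ℝ (s : Set H) with hW
  have : FiniteDimensional ℝ W := FiniteDimensional.span_finset ℝ s
  have hperp : ∀ u ∈ Wᗮ, ‖T u‖ ≤ ε / 2 * ‖u‖ := by
    intro u hu
    rcases eq_or_ne u 0 with rfl | hu0
    · simp
    have hn : 0 < ‖u‖ := norm_pos_iff.2 hu0
    have := hunit (‖u‖⁻¹ • u) (by rw [norm_smul, norm_inv, norm_norm, inv_mul_cancel₀ hn.ne'])
      fun e he => by
        rw [real_inner_smul_right, (Submodule.mem_orthogonal W u).1 hu e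
          (Submodule.subset_span he), mul_zero]
    rwa [map_smul, norm_smul, norm_inv, norm_norm, inv_mul_le_iff₀ hn, mul_comm] at this
  refine ⟨T ∘L W.starProjection, ?_, ?_⟩
  · have h1 : IsCompactOperator (T ∘L W.subtypeL) :=
      isCompactOperator_of_locallyCompactSpace_rng (T ∘L W.subtypeL)
    exact h1.comp_clm W.orthogonalProjectionOnto
  · rw [dist_eq_norm]
    refine lt_of_le_of_lt (ContinuousLinearMap.opNorm_le_bound _ (by positivity : 0 ≤ ε / 2)
      fun x => ?_) (half_lt_self hε)
    have h1 : (T - T ∘L W.starProjection) x = T (x - W.starProjection x) := by simp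
    rw [h1]
    refine (hperp _ (W.sub_starProjection_mem_orthogonal x)).trans ?_
    gcongr
    have := Wᗮ.norm_starProjection_apply_le x
    rwa [W.starProjection_orthogonal'] at this

/-! ### Integral operators on `L²` and the Fredholm alternative -/

namespace IntegralOperator

section SchurTest

variable {X E : Type*} [MeasurableSpace X] [NormedAddCommGroup E]

lemma eLpNorm_two_sq (μ : Measure X) (f : X → E) :
    eLpNorm f 2 μ ^ 2 = ∫⁻ x, ‖f x‖ₑ ^ 2 ∂μ := by
  have := eLpNorm_nnreal_pow_eq_lintegral (f := f) (μ := μ) (p := 2) two_ne_zero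
  simpa using this

/-- Schur's test: the `L²` estimate for a kernel whose rows and columns have integral at
most `C`. -/
lemma lintegral_sq_le {μ : Measure X} [SFinite μ] {κ : X → X → ℝ≥0∞}
    (hκ : Measurable fun p : X × X => κ p.1 p.2) {C : ℝ≥0∞}
    (h1 : ∀ x, ∫⁻ y, κ x y ∂μ ≤ C) (h2 : ∀ y, ∫⁻ x, κ x y ∂μ ≤ C)
    {w : X → ℝ≥0∞} (hw : Measurable w) :
    ∫⁻ x, (∫⁻ y, κ x y * w y ∂μ) ^ 2 ∂μ ≤ C ^ 2 * ∫⁻ y, w y ^ 2 ∂μ := by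
  have hm : ∀ x, Measurable (κ x) := fun x => hκ.comp measurable_prodMk_left
  have hrow : ∀ x, (∫⁻ y, κ x y * w y ∂μ) ^ 2 ≤ C * ∫⁻ y, κ x y * w y ^ 2 ∂μ := fun x => by
    have hcs := ENNReal.lintegral_mul_norm_pow_le (μ := μ) (f := κ x)
      (g := fun y => κ x y * w y ^ 2) (hm x).aemeasurable
      ((hm x).mul (hw.pow_const 2)).aemeasurable (p := 1 / 2) (q := 1 / 2)
      (by norm_num) (by norm_num) (by norm_num)
    have heq : ∀ y, κ x y ^ (1 / 2 : ℝ) * (κ x y * w y ^ 2) ^ (1 / 2 : ℝ) = κ x y * w y := by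
      intro y
      rw [← ENNReal.mul_rpow_of_nonneg _ _ (by norm_num), ← mul_assoc, ← sq, ← mul_pow,
        ← ENNReal.rpow_natCast, ← ENNReal.rpow_mul]
      norm_num
    simp only [heq] at hcs
    calc _ ≤ ((∫⁻ y, κ x y ∂μ) ^ (1 / 2 : ℝ) * (∫⁻ y, κ x y * w y ^ 2 ∂μ) ^ (1 / 2 : ℝ)) ^ 2 := by
          gcongr
      _ = (∫⁻ y, κ x y ∂μ) * ∫⁻ y, κ x y * w y ^ 2 ∂μ := by
          rw [mul_pow, ← ENNReal.rpow_natCast, ← ENNReal.rpow_natCast, ← ENNReal.rpow_mul,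
            ← ENNReal.rpow_mul]
          norm_num
      _ ≤ _ := by gcongr; exact h1 x
  have hmeas : Measurable fun p : X × X => κ p.1 p.2 * w p.2 ^ 2 :=
    hκ.mul ((hw.comp measurable_snd).pow_const 2)
  calc _ ≤ ∫⁻ x, C * ∫⁻ y, κ x y * w y ^ 2 ∂μ ∂μ := lintegral_mono hrow
    _ = C * ∫⁻ x, ∫⁻ y, κ x y * w y ^ 2 ∂μ ∂μ :=
        lintegral_const_mul _ hmeas.lintegral_prod_right'
    _ = C * ∫⁻ y, (∫⁻ x, κ x y ∂μ) * w y ^ 2 ∂μ := by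
        rw [lintegral_lintegral_swap hmeas.aemeasurable]
        congr 1
        refine lintegral_congr fun y => ?_
        exact lintegral_mul_const _ (hκ.comp measurable_prodMk_right)
    _ ≤ C * ∫⁻ y, C * w y ^ 2 ∂μ := by gcongr with y; exact h2 y
    _ = _ := by rw [lintegral_const_mul _ (hw.pow_const 2), sq, mul_assoc]

variable [NormedSpace ℝ E]

/-- The integral operator with kernel `k`. -/
def apply (μ : Measure X) (k : X → X → E →L[ℝ] E) (w : X → E) (x : X) : E :=
  ∫ y, k x y (w y) ∂μ

/-- The kernel `k` is measurable, and its rows and columns have integral at most `C`. -/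
structure SchurBound (μ : Measure X) (k : X → X → E →L[ℝ] E) (C : NNReal) : Prop where
  meas : StronglyMeasurable fun p : X × X => k p.1 p.2
  row : ∀ x, ∫⁻ y, ‖k x y‖ₑ ∂μ ≤ C
  col : ∀ y, ∫⁻ x, ‖k x y‖ₑ ∂μ ≤ C

variable {μ : Measure X} {k : X → X → E →L[ℝ] E} {C : NNReal}

lemma SchurBound.stronglyMeasurable_integrand (h : SchurBound μ k C) {w : X → E}
    (hw : StronglyMeasurable w) : StronglyMeasurable fun p : X × X => k p.1 p.2 (w p.2) :=
  isBoundedBilinearMap_apply.continuous.comp_stronglyMeasurable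
    (h.meas.prodMk (hw.comp_measurable measurable_snd))

lemma apply_congr {w w' : X → E} (h : w =ᵐ[μ] w') : apply μ k w = apply μ k w' := by
  funext x
  refine integral_congr_ae ?_
  filter_upwards [h] with y hy
  rw [hy]

lemma enorm_apply_le (w : X → E) (x : X) :
    ‖apply μ k w x‖ₑ ≤ ∫⁻ y, ‖k x y‖ₑ * ‖w y‖ₑ ∂μ :=
  (enorm_integral_le_lintegral_enorm _).trans
    (lintegral_mono fun y => (k x y).le_opENorm (w y))

lemma schurBound_of_norm_le [IsFiniteMeasure μ]
    (hm : StronglyMeasurable fun p : X × X => k p.1 p.2) {R : NNReal}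
    (hR : ∀ x y, ‖k x y‖ ≤ R) : SchurBound μ k (R * (μ univ).toNNReal) := by
  have h1 : ∀ x y, ‖k x y‖ₑ ≤ R := fun x y => by
    rw [← ofReal_norm, ← ENNReal.ofReal_coe_nnreal]
    exact ENNReal.ofReal_le_ofReal (hR x y)
  have h2 : ((R * (μ univ).toNNReal : NNReal) : ℝ≥0∞) = R * μ univ := by
    rw [ENNReal.coe_mul, ENNReal.coe_toNNReal (measure_ne_top μ univ)]
  refine ⟨hm, fun x => ?_, fun y => ?_⟩
  · rw [h2, ← lintegral_const]
    exact lintegral_mono fun y => h1 x y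
  · rw [h2, ← lintegral_const]
    exact lintegral_mono fun x => h1 x y

lemma SchurBound.norm_apply_le (h : SchurBound μ k C) {w : X → E} {c : ℝ}
    (hw : ∀ᵐ y ∂μ, ‖w y‖ ≤ c) (hc : 0 ≤ c) (x : X) : ‖apply μ k w x‖ ≤ C * c := by
  have h1 : ‖apply μ k w x‖ₑ ≤ ENNReal.ofReal (C * c) := by
    refine (enorm_apply_le w x).trans ?_
    calc _ ≤ ∫⁻ y, ‖k x y‖ₑ * ENNReal.ofReal c ∂μ := by
          refine lintegral_mono_ae ?_
          filter_upwards [hw] with y hy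
          gcongr
          rw [← ofReal_norm]
          exact ENNReal.ofReal_le_ofReal hy
      _ = (∫⁻ y, ‖k x y‖ₑ ∂μ) * ENNReal.ofReal c :=
          lintegral_mul_const _ (h.meas.comp_measurable measurable_prodMk_left).enorm
      _ ≤ C * ENNReal.ofReal c := by gcongr; exact h.row x
      _ = _ := by rw [ENNReal.ofReal_mul C.coe_nonneg, ENNReal.ofReal_coe_nnreal]
  rw [← ofReal_norm] at h1
  exact (ENNReal.ofReal_le_ofReal_iff (by positivity)).1 h1

variable [SFinite μ]

lemma SchurBound.lintegral_le (h : SchurBound μ k C) {w : X → E} (hw : StronglyMeasurable w) :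
    ∫⁻ x, (∫⁻ y, ‖k x y‖ₑ * ‖w y‖ₑ ∂μ) ^ 2 ∂μ ≤ (C * eLpNorm w 2 μ) ^ 2 := by
  rw [mul_pow, eLpNorm_two_sq]
  exact lintegral_sq_le h.meas.enorm h.row h.col hw.enorm

lemma SchurBound.ae_integrable (h : SchurBound μ k C) {w : X → E} (hw : MemLp w 2 μ) :
    ∀ᵐ x ∂μ, Integrable (fun y => k x y (w y)) μ := by
  wlog hw' : StronglyMeasurable w generalizing w
  · filter_upwards [this ((memLp_congr_ae hw.1.ae_eq_mk).1 hw) hw.1.stronglyMeasurable_mk] with x hx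
    refine hx.congr ?_
    filter_upwards [hw.1.ae_eq_mk] with y hy
    rw [hy]
  have h1 := h.lintegral_le hw'
  have hm : Measurable fun x => (∫⁻ y, ‖k x y‖ₑ * ‖w y‖ₑ ∂μ) ^ 2 := by
    refine Measurable.pow_const ?_ 2
    exact (h.meas.enorm.mul (hw'.enorm.comp measurable_snd)).lintegral_prod_right'
  filter_upwards [ae_lt_top hm (h1.trans_lt
    (ENNReal.pow_lt_top (ENNReal.mul_lt_top ENNReal.coe_lt_top hw.2))).ne] with x hx
  refine ⟨((h.stronglyMeasurable_integrand hw').comp_measurable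
    measurable_prodMk_left).aestronglyMeasurable, ?_⟩
  refine (lintegral_mono fun y => (k x y).le_opENorm (w y)).trans_lt ?_
  by_contra hcon
  rw [not_lt, top_le_iff] at hcon
  rw [hcon] at hx
  simp at hx

lemma SchurBound.memLp_apply (h : SchurBound μ k C) {w : X → E} (hw : MemLp w 2 μ) :
    MemLp (apply μ k w) 2 μ ∧ eLpNorm (apply μ k w) 2 μ ≤ C * eLpNorm w 2 μ := by
  wlog hw' : StronglyMeasurable w generalizing w
  · have := this ((memLp_congr_ae hw.1.ae_eq_mk).1 hw) hw.1.stronglyMeasurable_mk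
    rwa [← apply_congr hw.1.ae_eq_mk, ← eLpNorm_congr_ae hw.1.ae_eq_mk] at this
  have hle : eLpNorm (apply μ k w) 2 μ ≤ C * eLpNorm w 2 μ := by
    refine (ENNReal.pow_le_pow_left_iff two_ne_zero).1 ?_
    rw [eLpNorm_two_sq]
    refine (lintegral_mono fun x => ?_).trans (h.lintegral_le hw')
    gcongr
    exact enorm_apply_le w x
  exact ⟨⟨((h.stronglyMeasurable_integrand hw').integral_prod_right').aestronglyMeasurable,
    hle.trans_lt (ENNReal.mul_lt_top ENNReal.coe_lt_top hw.2)⟩, hle⟩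

/-- The integral operator on `L²` of a kernel satisfying Schur's test. -/
def SchurBound.toCLM (h : SchurBound μ k C) : Lp E 2 μ →L[ℝ] Lp E 2 μ :=
  LinearMap.mkContinuous
    { toFun := fun w => (h.memLp_apply (Lp.memLp w)).1.toLp (apply μ k w)
      map_add' := fun v w => by
        rw [← MemLp.toLp_add]
        refine MemLp.toLp_congr _ _ ?_
        filter_upwards [h.ae_integrable (Lp.memLp v), h.ae_integrable (Lp.memLp w)] with x hv hw
        rw [apply_congr (Lp.coeFn_add v w), Pi.add_apply, apply, apply, apply,
          ← integral_add hv hw]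
        simp
      map_smul' := fun c v => by
        rw [RingHom.id_apply, ← MemLp.toLp_const_smul]
        refine MemLp.toLp_congr _ _ (Eventually.of_forall fun x => ?_)
        rw [apply_congr (Lp.coeFn_smul c v), Pi.smul_apply, apply, apply, ← integral_smul]
        simp }
    C fun w => by
      change ‖(h.memLp_apply (Lp.memLp w)).1.toLp _‖ ≤ C * ‖w‖
      rw [Lp.norm_toLp, Lp.norm_def, ← ENNReal.coe_toReal, ← ENNReal.toReal_mul]
      exact ENNReal.toReal_mono (ENNReal.mul_ne_top ENNReal.coe_ne_top (Lp.eLpNorm_ne_top w))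
        (h.memLp_apply (Lp.memLp w)).2

lemma SchurBound.coeFn_toCLM (h : SchurBound μ k C) (w : Lp E 2 μ) :
    h.toCLM w =ᵐ[μ] apply μ k w :=
  (h.memLp_apply (Lp.memLp w)).1.coeFn_toLp

lemma SchurBound.norm_toCLM_le (h : SchurBound μ k C) : ‖h.toCLM‖ ≤ C :=
  LinearMap.mkContinuous_norm_le _ C.2 _

end SchurTest

section FredholmAlternative

variable {X E : Type*} [MeasurableSpace X] {μ : Measure X}

lemma isClosed_ae_norm_le [NormedAddCommGroup E] (c : ℝ) :
    IsClosed {v : Lp E 2 μ | ∀ᵐ x ∂μ, ‖v x‖ ≤ c} := by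
  refine IsSeqClosed.isClosed fun f v hf hv => ?_
  obtain ⟨ns, -, hns⟩ := (tendstoInMeasure_of_tendsto_Lp hv).exists_seq_tendsto_ae
  filter_upwards [hns, ae_all_iff.2 hf] with x hx hfx
  exact le_of_tendsto hx.norm (Eventually.of_forall fun i => hfx (ns i))

lemma norm_sq_eq_integral [NormedAddCommGroup E] [InnerProductSpace ℝ E] (f : Lp E 2 μ) :
    ‖f‖ ^ 2 = ∫ x, ‖f x‖ ^ 2 ∂μ := by
  rw [← real_inner_self_eq_norm_sq, L2.inner_def]
  simp only [real_inner_self_eq_norm_sq]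

variable [IsFiniteMeasure μ] [NormedAddCommGroup E] [InnerProductSpace ℝ E] [FiniteDimensional ℝ E]
  {k k₁ k₂ : X → X → E →L[ℝ] E} {C R : NNReal}

/-- An integral operator with bounded kernel is compact on `L²`. By Bessel's inequality in the
variable `y`, the sums `∑ ‖T e (x)‖²` over orthonormal families are bounded for each `x`. -/
lemma SchurBound.isCompactOperator_toCLM (h : SchurBound μ k C) (hR : ∀ x y, ‖k x y‖ ≤ R) :
    IsCompactOperator h.toCLM := by
  have := FiniteDimensional.complete ℝ E
  set d := Module.finrank ℝ E with hd
  set b := stdOrthonormalBasis ℝ E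
  have hrow : ∀ x, ∀ s : Finset (Lp E 2 μ), Orthonormal ℝ ((↑) : s → Lp E 2 μ) →
      (∀ e ∈ s, Integrable (fun y => k x y (e y)) μ) →
      ∑ e ∈ s, ‖apply μ k e x‖ ^ 2 ≤ d * (R ^ 2 * μ.real univ) := by
    intro x s hs hint
    have hcoord : ∀ j, ∑ e ∈ s, ‖(inner ℝ (b j) (apply μ k e x) : ℝ)‖ ^ 2 ≤
        R ^ 2 * μ.real univ := by
      intro j
      have hle : ∀ y, ‖ContinuousLinearMap.adjoint (k x y) (b j)‖ ≤ R := fun y => by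
        refine ((ContinuousLinearMap.adjoint (k x y)).le_opNorm _).trans ?_
        rw [b.norm_eq_one, mul_one, LinearIsometryEquiv.norm_map]
        exact hR x y
      have hmem : MemLp (fun y => ContinuousLinearMap.adjoint (k x y) (b j)) 2 μ := by
        refine MemLp.of_bound (StronglyMeasurable.aestronglyMeasurable ?_) R
          (Eventually.of_forall hle)
        have h1 := h.meas.comp_measurable (measurable_prodMk_left (x := x))
        exact (ContinuousLinearMap.apply ℝ E (b j)).continuous.comp_stronglyMeasurable
          ((ContinuousLinearMap.adjoint (𝕜 := ℝ) (E := E) (F := E)).continuous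
            |>.comp_stronglyMeasurable h1)
      set a : Lp E 2 μ := hmem.toLp _ with ha
      have hinner : ∀ e ∈ s, (inner ℝ e a : ℝ) = inner ℝ (b j) (apply μ k e x) := by
        intro e he
        rw [apply, ← integral_inner (hint e he), L2.inner_def]
        refine integral_congr_ae ?_
        filter_upwards [hmem.coeFn_toLp] with y hy
        rw [ha, hy, ContinuousLinearMap.adjoint_inner_right, real_inner_comm]
      have hbes := hs.sum_inner_products_le (x := a) (s := Finset.univ)
      rw [Finset.sum_coe_sort s (fun e => ‖(inner ℝ e a : ℝ)‖ ^ 2)] at hbes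
      have hsum : ∑ e ∈ s, ‖(inner ℝ (b j) (apply μ k e x) : ℝ)‖ ^ 2 =
          ∑ e ∈ s, ‖(inner ℝ e a : ℝ)‖ ^ 2 :=
        Finset.sum_congr rfl fun e he => by rw [hinner e he]
      rw [hsum]
      refine hbes.trans ?_
      rw [norm_sq_eq_integral]
      calc ∫ y, ‖a y‖ ^ 2 ∂μ ≤ ∫ _, (R : ℝ) ^ 2 ∂μ := by
            refine integral_mono_of_nonneg (Eventually.of_forall fun _ => by positivity)
              (integrable_const _) ?_
            filter_upwards [hmem.coeFn_toLp] with y hy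
            rw [ha, hy]
            have := hle y
            gcongr
        _ = _ := by rw [integral_const, smul_eq_mul, mul_comm]
    simp only [← b.sum_sq_norm_inner_right]
    rw [Finset.sum_comm]
    refine (Finset.sum_le_sum fun j _ => hcoord j).trans (le_of_eq ?_)
    simp [hd]
  refine isCompactOperator_of_sum_norm_sq_le _ (d * (R ^ 2 * μ.real univ) * μ.real univ)
    fun s hs => ?_
  simp only [norm_sq_eq_integral]
  rw [← integral_finsetSum]
  · calc _ ≤ ∫ _, (d * (R ^ 2 * μ.real univ) : ℝ) ∂μ := by
          refine integral_mono_of_nonneg (Eventually.of_forall fun _ => by positivity)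
            (integrable_const _) ?_
          filter_upwards [(s.eventually_all).2 fun e _ => h.coeFn_toCLM e,
            (s.eventually_all).2 fun e _ => h.ae_integrable (Lp.memLp e)] with x h1 h2
          refine (le_of_eq ?_).trans (hrow x s hs h2)
          exact Finset.sum_congr rfl fun e he => by rw [h1 e he]
      _ = _ := by rw [integral_const, smul_eq_mul, mul_comm]
  · intro e _
    exact (Lp.memLp (h.toCLM e)).integrable_norm_pow two_ne_zero

/-- Fredholm alternative for an equation of the second kind: `k₁` is a small kernel, `k₂` a bounded
one. If the homogeneous equation has only the trivial solution in `L²`, then the equation with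
bounded right-hand side has a bounded solution. -/
theorem exists_memLp_top_eq_add_apply (h₁ : SchurBound μ k₁ (1 / 2)) (h₂ : SchurBound μ k₂ C)
    (hR : ∀ x y, ‖k₂ x y‖ ≤ R)
    (hker : ∀ w, MemLp w 2 μ → w =ᵐ[μ] apply μ k₁ w + apply μ k₂ w → w =ᵐ[μ] 0)
    {f : X → E} (hf : MemLp f ∞ μ) :
    ∃ w, MemLp w ∞ μ ∧ w =ᵐ[μ] f + (apply μ k₁ w + apply μ k₂ w) := by
  have := FiniteDimensional.complete ℝ E
  set T₁ := h₁.toCLM with hT₁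
  set T₂ := h₂.toCLM with hT₂
  have hf2 : MemLp f 2 μ := hf.mono_exponent le_top
  have hnorm : ‖T₁‖ < 1 := h₁.norm_toCLM_le.trans_lt (by norm_num)
  obtain ⟨G, hG⟩ := isUnit_one_sub_of_norm_lt_one (R := Lp E 2 μ →L[ℝ] Lp E 2 μ) hnorm
  have hGapp : ∀ v, (G : Lp E 2 μ →L[ℝ] Lp E 2 μ) v = v - T₁ v := fun v => by rw [hG]; simp
  have hGinv : ∀ v, (G : Lp E 2 μ →L[ℝ] Lp E 2 μ)
      ((↑G⁻¹ : Lp E 2 μ →L[ℝ] Lp E 2 μ) v) = v := fun v => by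
    rw [← mul_apply_eq_comp, G.mul_inv, one_apply_eq_self]
  have hcomp : IsCompactOperator ((↑G⁻¹ : Lp E 2 μ →L[ℝ] Lp E 2 μ) ∘L T₂) :=
    (h₂.isCompactOperator_toCLM hR).clm_comp (↑G⁻¹ : Lp E 2 μ →L[ℝ] Lp E 2 μ)
  -- solvability in `L²`
  obtain ⟨w, hw⟩ : ∃ w : Lp E 2 μ, w = hf2.toLp f + T₂ w + T₁ w := by
    rcases hcomp.hasEigenvalue_or_mem_resolventSet one_ne_zero with h | h
    · obtain ⟨w, hw⟩ := h.exists_hasEigenvector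
      refine absurd ?_ hw.2
      have h1 : (↑G⁻¹ : Lp E 2 μ →L[ℝ] Lp E 2 μ) (T₂ w) = w := by
        simpa using hw.apply_eq_smul
      have h2 : T₂ w = w - T₁ w := by rw [← hGapp, ← hGinv (T₂ w), h1]
      have h3 : w = T₁ w + T₂ w := by rw [h2]; abel
      rw [Lp.eq_zero_iff_ae_eq_zero]
      refine hker w (Lp.memLp w) ?_
      filter_upwards [h₁.coeFn_toCLM w, h₂.coeFn_toCLM w, Lp.coeFn_add (T₁ w) (T₂ w)]
        with x e1 e2 e3
      rw [← h3, Pi.add_apply, e1, e2] at e3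
      exact e3
    · rw [spectrum.mem_resolventSet_iff, ContinuousLinearMap.isUnit_iff_bijective] at h
      obtain ⟨w, hw⟩ := h.2 ((↑G⁻¹ : Lp E 2 μ →L[ℝ] Lp E 2 μ) (hf2.toLp f))
      refine ⟨w, ?_⟩
      have h1 : w - (↑G⁻¹ : Lp E 2 μ →L[ℝ] Lp E 2 μ) (T₂ w) =
          (↑G⁻¹ : Lp E 2 μ →L[ℝ] Lp E 2 μ) (hf2.toLp f) := by
        simpa using hw
      have h2 := congrArg (G : Lp E 2 μ →L[ℝ] Lp E 2 μ) h1
      rw [map_sub, hGinv, hGinv, hGapp] at h2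
      rw [← h2]
      abel
  have hwae : (w : X → E) =ᵐ[μ] f + (apply μ k₁ w + apply μ k₂ w) := by
    filter_upwards [h₁.coeFn_toCLM w, h₂.coeFn_toCLM w, Lp.coeFn_add (hf2.toLp f + T₂ w) (T₁ w),
      Lp.coeFn_add (hf2.toLp f) (T₂ w), hf2.coeFn_toLp] with x e1 e2 e3 e4 e5
    rw [← hw, Pi.add_apply, e4, Pi.add_apply, e1, e2, e5] at e3
    rw [e3, Pi.add_apply, Pi.add_apply]
    abel
  refine ⟨w, ?_, hwae⟩
  -- boundedness: the contraction `v ↦ g + T₁ v` with bounded `g` preserves a closed set of bounded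
  -- functions
  set g := hf2.toLp f + T₂ w with hg
  obtain ⟨c, hc0, hc⟩ : ∃ c, 0 ≤ c ∧ ∀ᵐ x ∂μ, ‖g x‖ ≤ c := by
    have hwint : Integrable (fun y => ‖w y‖) μ :=
      ((Lp.memLp w).integrable (by norm_num)).norm
    refine ⟨(eLpNormEssSup f μ).toReal + R * ∫ y, ‖w y‖ ∂μ, by positivity, ?_⟩
    filter_upwards [h₂.coeFn_toCLM w, Lp.coeFn_add (hf2.toLp f) (T₂ w), hf2.coeFn_toLp,
      ae_le_eLpNormEssSup (f := f) (μ := μ)] with x e1 e2 e3 e4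
    rw [hg, e2, Pi.add_apply, e3, e1]
    refine (norm_add_le _ _).trans (add_le_add ?_ ?_)
    · rw [← toReal_enorm]
      refine ENNReal.toReal_mono ?_ e4
      rw [← eLpNorm_exponent_top]
      exact hf.2.ne
    · rw [apply, ← integral_const_mul]
      refine norm_integral_le_of_norm_le (hwint.const_mul _) (Eventually.of_forall fun y => ?_)
      exact ((k₂ x y).le_opNorm _).trans (mul_le_mul_of_nonneg_right (hR x y) (norm_nonneg _))
  set s : Set (Lp E 2 μ) := {v | ∀ᵐ x ∂μ, ‖v x‖ ≤ 2 * c} with hs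
  set Φ : Lp E 2 μ → Lp E 2 μ := fun v => g + T₁ v with hΦ
  have hmaps : MapsTo Φ s s := fun v hv => by
    have hv' : ∀ᵐ x ∂μ, ‖v x‖ ≤ 2 * c := hv
    change ∀ᵐ x ∂μ, ‖Φ v x‖ ≤ 2 * c
    filter_upwards [hc, h₁.coeFn_toCLM v, Lp.coeFn_add g (T₁ v)] with x e1 e2 e3
    rw [hΦ, e3, Pi.add_apply, e2]
    have h3 := h₁.norm_apply_le hv' (by positivity) x
    have h4 := norm_add_le (g x) (apply μ k₁ v x)
    push_cast at h3
    linarith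
  have hΦc : ContractingWith (1 / 2) Φ := by
    refine ⟨by norm_num, LipschitzWith.of_dist_le_mul fun u v => ?_⟩
    rw [dist_eq_norm, dist_eq_norm]
    have : Φ u - Φ v = T₁ (u - v) := by simp [hΦ]
    rw [this]
    exact T₁.le_of_opNorm_le h₁.norm_toCLM_le _
  have h0 : (0 : Lp E 2 μ) ∈ s := by
    change ∀ᵐ x ∂μ, ‖(0 : Lp E 2 μ) x‖ ≤ 2 * c
    filter_upwards [Lp.coeFn_zero E 2 μ] with x hx
    rw [hx, Pi.zero_apply, norm_zero]
    positivity
  obtain ⟨v, hv, hfix, -⟩ := (hΦc.restrict hmaps).exists_fixedPoint'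
    (isClosed_ae_norm_le (2 * c)).isComplete hmaps h0 (edist_ne_top _ _)
  have hwfix : Function.IsFixedPt Φ w := hw.symm
  have : w = v := hΦc.fixedPoint_unique' hwfix hfix
  exact memLp_top_of_bound (Lp.memLp w).1 (2 * c) (this ▸ hv)

end FredholmAlternative

end IntegralOperator

/-! ### Smoothness of the force operator -/

namespace Peridynamics
namespace Model

variable {n : ℕ} (M : Model n)

/-- The singularity `|z|^{-3/2}` of the second order terms is integrable, as `n ≥ 2`. -/
lemma integrableOn_inv_norm_mul_inv_sqrt_ball :
    IntegrableOn (fun z : Space n => ‖z‖⁻¹ * (√‖z‖)⁻¹) (Metric.ball 0 M.ε) := by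
  have hn : 2 ≤ n := by rcases M.dim with h | h <;> omega
  have : Nonempty (Fin n) := ⟨⟨0, by omega⟩⟩
  rw [integrableOn_fun_norm_addHaar volume (f := fun r : ℝ => r⁻¹ * (√r)⁻¹)]
  have h1 : Module.finrank ℝ (Space n) - 1 = (n - 2) + 1 := by
    rw [finrank_euclideanSpace_fin]; omega
  have h2 : IntegrableOn (fun r : ℝ => r ^ (-(1 / 2) : ℝ)) (Ioo 0 M.ε) :=
    (intervalIntegral.integrableOn_Ioo_rpow_iff M.ε_pos).2 (by norm_num)
  refine Integrable.mono' (h2.const_mul (M.ε ^ (n - 2))) (by fun_prop) ?_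
  refine (ae_restrict_iff' measurableSet_Ioo).2 (Eventually.of_forall fun r hr => ?_)
  have h3 : (√r)⁻¹ = r ^ (-(1 / 2) : ℝ) := by
    rw [Real.sqrt_eq_rpow, Real.rpow_neg hr.1.le]
  rw [h1, pow_succ, smul_eq_mul, h3, mul_assoc, mul_inv_cancel_left₀ hr.1.ne', norm_mul, norm_pow,
    Real.norm_of_nonneg hr.1.le, Real.norm_of_nonneg (Real.rpow_nonneg hr.1.le _)]
  exact mul_le_mul_of_nonneg_right (pow_le_pow_left₀ hr.1.le hr.2.le _)
    (Real.rpow_nonneg hr.1.le _)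

lemma exists_integral_inv_norm_mul_inv_sqrt_le :
    ∃ C, 0 ≤ C ∧ ∀ x : Space n,
      IntegrableOn (fun y => ‖y - x‖⁻¹ * (√‖y - x‖)⁻¹) (Metric.ball x M.ε ∩ M.Ω) ∧
      ∫ y in Metric.ball x M.ε ∩ M.Ω, ‖y - x‖⁻¹ * (√‖y - x‖)⁻¹ ≤ C := by
  refine ⟨∫ z in Metric.ball (0 : Space n) M.ε, ‖z‖⁻¹ * (√‖z‖)⁻¹, by positivity, fun x => ?_⟩
  have h2 : (fun y : Space n => y - x) ⁻¹' Metric.ball 0 M.ε = Metric.ball x M.ε := by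
    ext y; simp [dist_eq_norm]
  have hint : IntegrableOn (fun y => ‖y - x‖⁻¹ * (√‖y - x‖)⁻¹) (Metric.ball x M.ε) := by
    have := (measurePreserving_sub_right (volume : Measure (Space n)) x).integrableOn_comp_preimage
      (MeasurableEquiv.subRight x).measurableEmbedding
      (f := fun z : Space n => ‖z‖⁻¹ * (√‖z‖)⁻¹) (s := Metric.ball 0 M.ε)
    rw [h2] at this
    exact this.2 M.integrableOn_inv_norm_mul_inv_sqrt_ball
  refine ⟨hint.mono_set inter_subset_left, ?_⟩
  rw [← (measurePreserving_sub_right (volume : Measure (Space n)) x).setIntegral_preimage_emb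
    (MeasurableEquiv.subRight x).measurableEmbedding
    (fun z : Space n => ‖z‖⁻¹ * (√‖z‖)⁻¹), h2]
  exact setIntegral_mono_set hint (Eventually.of_forall fun y => by positivity)
    (Eventually.of_forall inter_subset_left)

lemma coe_force (S : BondSet n) (u : M.Linf) :
    ((M.force S u : M.Linf) : Space n → Space n) =ᵐ[M.vol] M.forceFun S u :=
  (M.memLp_forceFun S u).coeFn_toLp

lemma coe_lin (S : BondSet n) (u : M.Linf) (w : M.V) :
    ((M.lin S u w : M.Linf) : Space n → Space n) =ᵐ[M.vol] M.linFun S u w :=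
  (M.memLp_linFun S u w).coeFn_toLp

lemma norm_V_le {v : M.V} {C : ℝ} (hC : 0 ≤ C) (h : ∀ᵐ x ∂M.vol, ‖(v : M.Linf) x‖ ≤ C) :
    ‖v‖ ≤ C := by
  change ‖(v : M.Linf)‖ ≤ C
  rw [Lp.norm_def, eLpNorm_exponent_top]
  exact ENNReal.toReal_le_of_le_ofReal hC (eLpNormEssSup_le_of_ae_bound h)

lemma exists_abs_ddg_sub_le : ∃ C, 0 ≤ C ∧ ∀ a b,
    |iteratedDeriv 2 M.g a - iteratedDeriv 2 M.g b| ≤ C * |a - b| := by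
  obtain ⟨C, hC⟩ := M.bounded_g 3 le_rfl
  refine ⟨C, (abs_nonneg _).trans (hC 0), fun a b => ?_⟩
  refine convex_univ.norm_image_sub_le_of_norm_deriv_le
    (fun x _ => M.differentiable_g 2 (by norm_num) x) (fun x _ => ?_) (mem_univ b) (mem_univ a)
  rw [← iteratedDeriv_succ]
  exact hC x

lemma hasDerivAt_dg (r : ℝ) : HasDerivAt (deriv M.g) (iteratedDeriv 2 M.g r) r := by
  rw [iteratedDeriv_succ, iteratedDeriv_one, hasDerivAt_deriv_iff, ← iteratedDeriv_one]
  exact M.differentiable_g 1 (by norm_num) r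

lemma exists_abs_dg_sub_le : ∃ C, 0 ≤ C ∧ ∀ a b,
    |deriv M.g a - deriv M.g b| ≤ C * |a - b| := by
  obtain ⟨C, hC⟩ := M.bounded_g 2 (by norm_num)
  refine ⟨C, (abs_nonneg _).trans (hC 0), fun a b => ?_⟩
  refine convex_univ.norm_image_sub_le_of_norm_hasDerivWithin_le
    (fun x _ => (M.hasDerivAt_dg x).hasDerivWithinAt) (fun x _ => hC x) (mem_univ b) (mem_univ a)

lemma exists_abs_dg_taylor_le : ∃ C, 0 ≤ C ∧ ∀ a b,
    |deriv M.g (a + b) - deriv M.g a - iteratedDeriv 2 M.g a * b| ≤ C * b ^ 2 := by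
  obtain ⟨C, hC0, hC⟩ := M.exists_abs_ddg_sub_le
  refine ⟨C / 2, by positivity, fun a b => ?_⟩
  have := NewtonKantorovich.norm_sub_sub_le
    (F := deriv M.g) (F' := fun r => ContinuousLinearMap.toSpanSingleton ℝ (iteratedDeriv 2 M.g r))
    (fun r => (M.hasDerivAt_dg r).hasFDerivAt) hC0 (fun x y => ?_) a (a + b) a
  · simp only [add_sub_cancel_left, sub_self, norm_zero, add_zero,
      ContinuousLinearMap.toSpanSingleton_apply, Real.norm_eq_abs, smul_eq_mul] at this
    rwa [mul_assoc (C / 2), abs_mul_abs_self, ← sq, mul_comm b] at this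
  · refine ContinuousLinearMap.opNorm_le_bound _ (by positivity) fun z => ?_
    simp only [sub_apply, ContinuousLinearMap.toSpanSingleton_apply, smul_eq_mul, ← mul_sub,
      Real.norm_eq_abs, abs_mul]
    rw [mul_comm]
    gcongr
    exact hC x y

lemma strain_sub (y x : Space n) (v w : Space n → Space n) :
    strain y x (fun z => v z - w z) = strain y x v - strain y x w := by
  simp only [strain]
  rw [← inner_sub_left, ← smul_sub]
  congr 2
  abel

lemma ae_strain_sub_eq (w w' : M.Linf) : ∀ᵐ x ∂M.vol,
    ∀ᵐ y ∂volume.restrict (Metric.ball x M.ε ∩ M.Ω),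
      strain y x w - strain y x w' = strain y x (w - w' : M.Linf) := by
  filter_upwards [Lp.coeFn_sub w w'] with x hx
  filter_upwards [M.ae_near (Lp.coeFn_sub w w') x] with y hy
  rw [← strain_sub]
  exact (strain_congr hy hx).symm

lemma ae_abs_strain_le (w : M.Linf) : ∀ᵐ x ∂M.vol,
    ∀ᵐ y ∂volume.restrict (Metric.ball x M.ε ∩ M.Ω),
      |strain y x w| ≤ 2 * ‖w‖ * ‖y - x‖⁻¹ := by
  filter_upwards [M.ae_norm_le w] with x hx
  filter_upwards [M.ae_near (M.ae_norm_le w) x] with y hy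
  refine (abs_strain_le y x w).trans ?_
  have : ‖w y - w x‖ ≤ 2 * ‖w‖ := (norm_sub_le _ _).trans (by linarith)
  gcongr

lemma sqrt_mul_inv_eq (r : ℝ) : √r * r⁻¹ = (√r)⁻¹ := by
  rw [← div_eq_mul_inv, Real.sqrt_div_self]

lemma inv_sqrt_mul_inv_sqrt {r : ℝ} (hr : 0 ≤ r) : (√r)⁻¹ * (√r)⁻¹ = r⁻¹ := by
  rw [← mul_inv, Real.mul_self_sqrt hr]

lemma exists_linIntegrand_sub_le (S : BondSet n) : ∃ C, 0 ≤ C ∧ ∀ w w' v : M.Linf,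
    ∀ᵐ x ∂M.vol, ∀ᵐ y ∂volume.restrict (Metric.ball x M.ε ∩ M.Ω),
      ‖M.linIntegrand S w v x y - M.linIntegrand S w' v x y‖ ≤
        C * ‖w - w'‖ * ‖v‖ * (‖y - x‖⁻¹ * (√‖y - x‖)⁻¹) := by
  obtain ⟨W, hW0, hW⟩ := M.exists_weight_le
  obtain ⟨G, hG0, hG⟩ := M.exists_abs_ddg_sub_le
  refine ⟨8 * W * G, by positivity, fun w w' v => ?_⟩
  filter_upwards [M.ae_strain_sub_eq w w', M.ae_abs_strain_le (w - w'),
    M.ae_abs_strain_le v] with x h1 h2 h3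
  filter_upwards [h1, h2, h3] with y h1 h2 h3
  have h4 : |√‖y - x‖ * strain y x w - √‖y - x‖ * strain y x w'| ≤
      2 * ‖w - w'‖ * (√‖y - x‖)⁻¹ := by
    rw [← mul_sub, h1, abs_mul, abs_of_nonneg (Real.sqrt_nonneg _)]
    calc _ ≤ √‖y - x‖ * (2 * ‖w - w'‖ * ‖y - x‖⁻¹) := by gcongr
      _ = 2 * ‖w - w'‖ * (√‖y - x‖ * ‖y - x‖⁻¹) := by ring
      _ = _ := by rw [sqrt_mul_inv_eq]
  rw [linIntegrand, linIntegrand, ← sub_smul, ← sub_mul, ← mul_sub, norm_smul, Real.norm_eq_abs,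
    abs_mul, abs_mul, abs_mul, abs_mul, abs_two]
  calc _ ≤ 2 * 1 * W * (G * (2 * ‖w - w'‖ * (√‖y - x‖)⁻¹)) * (2 * ‖v‖ * ‖y - x‖⁻¹) * 1 := by
        gcongr
        · exact abs_intact_le S y x
        · exact hW y x
        · exact (hG _ _).trans (by gcongr)
        · exact norm_bondDir_le y x
    _ = _ := by ring

lemma exists_forceIntegrand_sub_le (S : BondSet n) : ∃ C, 0 ≤ C ∧ ∀ w w' : M.Linf,
    ∀ᵐ x ∂M.vol, ∀ᵐ y ∂volume.restrict (Metric.ball x M.ε ∩ M.Ω),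
      ‖M.forceIntegrand S w x y - M.forceIntegrand S w' x y‖ ≤
        C * ‖w - w'‖ * ‖y - x‖⁻¹ := by
  obtain ⟨W, hW0, hW⟩ := M.exists_weight_le
  obtain ⟨G, hG0, hG⟩ := M.exists_abs_dg_sub_le
  refine ⟨4 * W * G, by positivity, fun w w' => ?_⟩
  filter_upwards [M.ae_strain_sub_eq w w', M.ae_abs_strain_le (w - w')] with x h1 h2
  filter_upwards [h1, h2] with y h1 h2
  have h4 : |√‖y - x‖ * strain y x w - √‖y - x‖ * strain y x w'| ≤
      2 * ‖w - w'‖ * (√‖y - x‖)⁻¹ := by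
    rw [← mul_sub, h1, abs_mul, abs_of_nonneg (Real.sqrt_nonneg _)]
    calc _ ≤ √‖y - x‖ * (2 * ‖w - w'‖ * ‖y - x‖⁻¹) := by gcongr
      _ = 2 * ‖w - w'‖ * (√‖y - x‖ * ‖y - x‖⁻¹) := by ring
      _ = _ := by rw [sqrt_mul_inv_eq]
  rw [forceIntegrand, forceIntegrand, ← sub_smul, ← mul_sub, norm_smul, Real.norm_eq_abs,
    abs_mul, abs_div, abs_mul, abs_mul, abs_two, abs_of_nonneg (Real.sqrt_nonneg _),
    div_eq_mul_inv]
  calc _ ≤ 2 * 1 * W * (√‖y - x‖)⁻¹ * (G * (2 * ‖w - w'‖ * (√‖y - x‖)⁻¹)) * 1 := by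
        gcongr
        · exact abs_intact_le S y x
        · exact hW y x
        · exact (hG _ _).trans (by gcongr)
        · exact norm_bondDir_le y x
    _ = 4 * W * G * ‖w - w'‖ * ((√‖y - x‖)⁻¹ * (√‖y - x‖)⁻¹) := by ring
    _ = _ := by rw [inv_sqrt_mul_inv_sqrt (norm_nonneg _)]

/-- The second order remainder of the force in one bond is of order `b² / √|y - x|` with
`b = √|y - x| S(y, x, v) = O(|y - x|^{-1/2})`, hence has a singularity `|y - x|^{-3/2}`. -/
lemma exists_forceIntegrand_taylor_le (S : BondSet n) : ∃ C, 0 ≤ C ∧ ∀ u v : M.Linf,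
    ∀ᵐ x ∂M.vol, ∀ᵐ y ∂volume.restrict (Metric.ball x M.ε ∩ M.Ω),
      ‖M.forceIntegrand S (u + v : M.Linf) x y - M.forceIntegrand S u x y -
          M.linIntegrand S u v x y‖ ≤
        C * ‖v‖ ^ 2 * (‖y - x‖⁻¹ * (√‖y - x‖)⁻¹) := by
  obtain ⟨W, hW0, hW⟩ := M.exists_weight_le
  obtain ⟨G, hG0, hG⟩ := M.exists_abs_dg_taylor_le
  refine ⟨8 * W * G, by positivity, fun u v => ?_⟩
  filter_upwards [M.ae_strain_sub_eq (u + v) u, M.ae_abs_strain_le v] with x h1 h2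
  filter_upwards [h1, h2] with y h1 h2
  rw [add_sub_cancel_left, sub_eq_iff_eq_add'] at h1
  set s := √‖y - x‖ with hs
  have hs0 : 0 ≤ s := Real.sqrt_nonneg _
  have h4 : |s * strain y x v| ≤ 2 * ‖v‖ * s⁻¹ := by
    rw [abs_mul, abs_of_nonneg hs0]
    calc _ ≤ s * (2 * ‖v‖ * ‖y - x‖⁻¹) := by gcongr
      _ = 2 * ‖v‖ * (s * ‖y - x‖⁻¹) := by ring
      _ = _ := by rw [hs, sqrt_mul_inv_eq]
  -- on the diagonal `s = 0` and the strain vanishes too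
  have h5 : strain y x v = s⁻¹ * (s * strain y x v) := by
    by_cases h : s = 0
    · have : y - x = 0 := by
        rwa [hs, Real.sqrt_eq_zero (norm_nonneg _), norm_eq_zero] at h
      simp [strain, this]
    · rw [inv_mul_cancel_left₀ h]
  have h6 : M.forceIntegrand S (u + v : M.Linf) x y - M.forceIntegrand S u x y -
      M.linIntegrand S u v x y = (2 * intact S y x * M.weight y x * s⁻¹ *
        (deriv M.g (s * strain y x u + s * strain y x v) - deriv M.g (s * strain y x u) -
          iteratedDeriv 2 M.g (s * strain y x u) * (s * strain y x v))) • bondDir y x := by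
    rw [forceIntegrand, forceIntegrand, linIntegrand, ← sub_smul, ← sub_smul, ← hs, h1, mul_add]
    congr 1
    linear_combination (-(2 * intact S y x * M.weight y x *
      iteratedDeriv 2 M.g (s * strain y x u))) * h5
  rw [h6, norm_smul, Real.norm_eq_abs, abs_mul, abs_mul, abs_mul, abs_mul, abs_two,
    abs_of_nonneg (inv_nonneg.2 hs0)]
  calc _ ≤ 2 * 1 * W * s⁻¹ * (G * (2 * ‖v‖ * s⁻¹) ^ 2) * 1 := by
        gcongr
        · exact abs_intact_le S y x
        · exact hW y x
        · refine (hG _ _).trans ?_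
          rw [← sq_abs]
          gcongr
        · exact norm_bondDir_le y x
    _ = 8 * W * G * ‖v‖ ^ 2 * ((s⁻¹ * s⁻¹) * s⁻¹) := by ring
    _ = _ := by rw [hs, inv_sqrt_mul_inv_sqrt (norm_nonneg _)]

lemma integrable_forceIntegrand (S : BondSet n) (u : M.Linf) (x : Space n) :
    IntegrableOn (M.forceIntegrand S u x) (Metric.ball x M.ε ∩ M.Ω) := by
  obtain ⟨A, -, hA⟩ := M.exists_forceIntegrand_le S
  refine Integrable.mono' ((M.integrableOn_inv_norm x).const_mul A) ?_
    ((ae_restrict_iff' (measurableSet_ball.inter M.isOpen_Ω.measurableSet)).2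
      (Eventually.of_forall fun y hy => hA u x y hy.1))
  exact ((M.measurable_forceIntegrand S (M.measurable_rep u)).comp
    (measurable_id.prodMk measurable_const)).aestronglyMeasurable

lemma norm_neg_integral_le {F : Space n → Space n} {φ : Space n → ℝ} {s : Set (Space n)} {A C : ℝ}
    (hA : 0 ≤ A) (hφ : IntegrableOn φ s) (hC : ∫ y in s, φ y ≤ C)
    (hF : ∀ᵐ y ∂volume.restrict s, ‖F y‖ ≤ A * φ y) :
    ‖-∫ y in s, F y‖ ≤ A * C := by
  rw [norm_neg]
  refine (norm_integral_le_of_norm_le (hφ.const_mul A) hF).trans ?_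
  rw [integral_const_mul]
  gcongr

/-- The linearization depends Lipschitz continuously on the displacement. -/
theorem exists_lin_sub_le (S : BondSet n) : ∃ K, 0 < K ∧ ∀ w w' : M.Linf,
    ‖M.lin S w - M.lin S w'‖ ≤ K * ‖w - w'‖ := by
  obtain ⟨A, hA0, hA⟩ := M.exists_linIntegrand_sub_le S
  obtain ⟨C, hC0, hC⟩ := M.exists_integral_inv_norm_mul_inv_sqrt_le
  have key : ∀ w w' : M.Linf, ‖M.lin S w - M.lin S w'‖ ≤ A * C * ‖w - w'‖ := fun w w' => by
    refine ContinuousLinearMap.opNorm_le_bound _ (by positivity) fun v => ?_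
    refine M.norm_V_le (by positivity) ?_
    filter_upwards [Lp.coeFn_sub (M.lin S w v : M.Linf) (M.lin S w' v), M.coe_lin S w v,
      M.coe_lin S w' v, M.integrable_linIntegrand S w v, M.integrable_linIntegrand S w' v,
      hA w w' v] with x h1 h2 h3 h4 h5 h6
    rw [sub_apply, Submodule.coe_sub, h1, Pi.sub_apply, h2, h3]
    by_cases hD : x ∈ M.D
    · simp only [linFun, indicator_of_mem hD]
      rw [← neg_sub_neg, neg_neg, neg_neg, ← neg_sub, ← integral_sub h4 h5]
      refine (norm_neg_integral_le (by positivity) (hC x).1 (hC x).2 h6).trans (le_of_eq ?_)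
      rw [Submodule.coe_norm]
      ring
    · simp only [linFun, indicator_of_notMem hD, sub_zero, norm_zero]
      positivity
  refine ⟨A * C + 1, by positivity, fun w w' => (key w w').trans ?_⟩
  gcongr
  linarith

/-- The force density depends Lipschitz continuously on the displacement. -/
theorem exists_force_sub_le (S : BondSet n) : ∃ C, 0 ≤ C ∧ ∀ w w' : M.Linf,
    ‖M.force S w - M.force S w'‖ ≤ C * ‖w - w'‖ := by
  obtain ⟨A, hA0, hA⟩ := M.exists_forceIntegrand_sub_le S
  obtain ⟨C, hC0, hC⟩ := M.exists_integral_inv_norm_le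
  refine ⟨A * C, by positivity, fun w w' => M.norm_V_le (by positivity) ?_⟩
  filter_upwards [Lp.coeFn_sub (M.force S w : M.Linf) (M.force S w'), M.coe_force S w,
    M.coe_force S w', hA w w'] with x h1 h2 h3 h6
  rw [Submodule.coe_sub, h1, Pi.sub_apply, h2, h3]
  by_cases hD : x ∈ M.D
  · simp only [forceFun, indicator_of_mem hD]
    rw [← neg_sub_neg, neg_neg, neg_neg, ← neg_sub, ← integral_sub
      (M.integrable_forceIntegrand S w x) (M.integrable_forceIntegrand S w' x)]
    exact (norm_neg_integral_le (by positivity) (M.integrableOn_inv_norm x) (hC x) h6).trans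
      (le_of_eq (by ring))
  · simp only [forceFun, indicator_of_notMem hD, sub_zero, norm_zero]
    positivity

theorem exists_force_taylor_le (S : BondSet n) : ∃ C, 0 ≤ C ∧ ∀ (u : M.Linf) (v : M.V),
    ‖M.force S (u + v) - M.force S u - M.lin S u v‖ ≤ C * ‖v‖ ^ 2 := by
  obtain ⟨A, hA0, hA⟩ := M.exists_forceIntegrand_taylor_le S
  obtain ⟨C, hC0, hC⟩ := M.exists_integral_inv_norm_mul_inv_sqrt_le
  refine ⟨A * C, by positivity, fun u v => M.norm_V_le (by positivity) ?_⟩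
  filter_upwards [Lp.coeFn_sub (M.force S (u + v) - M.force S u : M.Linf) (M.lin S u v),
    Lp.coeFn_sub (M.force S (u + v) : M.Linf) (M.force S u), M.coe_force S (u + v),
    M.coe_force S u, M.coe_lin S u v, M.integrable_linIntegrand S u v, hA u v]
    with x h0 h1 h2 h3 h4 h5 h6
  rw [Submodule.coe_sub, Submodule.coe_sub, h0, Pi.sub_apply, h1, Pi.sub_apply, h2, h3, h4]
  by_cases hD : x ∈ M.D
  · simp only [forceFun, linFun, indicator_of_mem hD]
    have i1 := M.integrable_forceIntegrand S (u + v) x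
    have i2 := M.integrable_forceIntegrand S u x
    have : ∀ a b c : Space n, -a - -b - -c = -(a - b - c) := fun a b c => by abel
    have i3 : IntegrableOn (fun y => M.forceIntegrand S (u + v : M.Linf) x y -
        M.forceIntegrand S u x y) (Metric.ball x M.ε ∩ M.Ω) := i1.sub i2
    rw [this, ← integral_sub i1 i2, ← integral_sub i3 h5]
    refine (norm_neg_integral_le (by positivity) (hC x).1 (hC x).2 h6).trans (le_of_eq ?_)
    rw [Submodule.coe_norm]
    ring
  · simp only [forceFun, linFun, indicator_of_notMem hD, sub_zero, norm_zero]
    positivity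

/-- For fixed boundary values `U`, the operator `ℒ'` is the Fréchet derivative of `ℒ` along `𝒱`. -/
theorem hasFDerivAt_force (S : BondSet n) (U : M.Linf) (v : M.V) :
    HasFDerivAt (fun v : M.V => M.force S (v + U)) (M.lin S (v + U)) v := by
  obtain ⟨C, hC0, hC⟩ := M.exists_force_taylor_le S
  rw [hasFDerivAt_iff_isLittleO_nhds_zero]
  refine Asymptotics.IsBigO.trans_isLittleO (g := fun h : M.V => ‖h‖ ^ 2) ?_
    (Asymptotics.isLittleO_norm_pow_id one_lt_two)
  refine Asymptotics.IsBigO.of_bound C (Eventually.of_forall fun h => ?_)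
  have h1 : ((v + h : M.V) : M.Linf) + U = (v + U : M.Linf) + h := by
    rw [Submodule.coe_add]; abel
  rw [h1, norm_pow, norm_norm]
  exact hC _ _

/-- Breaking in addition the bonds broken by `u` does not change the force density at `u`: these
bonds carry no force. -/
theorem force_breakBonds (S : BondSet n) (u : M.Linf) :
    M.force (M.breakBonds S u) u = M.force S u := by
  have h : M.forceFun (M.breakBonds S u) u = M.forceFun S u := by
    have : ∀ x y, M.forceIntegrand (M.breakBonds S u) u x y = M.forceIntegrand S u x y := by
      intro x y
      by_cases hb : (y, x) ∈ M.brokenBy u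
      · simp only [forceIntegrand, hb.2.2.2.1, mul_zero]
      · have : intact (M.breakBonds S u) y x = intact S y x := by
          by_cases hS : (y, x) ∈ S.1 <;> simp [intact, breakBonds, hb, hS]
        simp only [forceIntegrand, this]
    simp only [forceFun, this]
  refine Subtype.ext (Lp.ext ?_)
  exact (M.coe_force _ u).trans (h ▸ (M.coe_force S u).symm)

end Model
end Peridynamics

/-! ### The stability tensor -/

lemma stronglyMeasurable_rankOne {X E : Type*} [MeasurableSpace X] [NormedAddCommGroup E]
    [InnerProductSpace ℝ E] {a : X → E} (ha : StronglyMeasurable a) :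
    StronglyMeasurable fun p => InnerProductSpace.rankOne ℝ (a p) (a p) := by
  have hc : Continuous fun q : E => InnerProductSpace.rankOne ℝ q q := by
    have h1 : Continuous fun q : E => ContinuousLinearMap.smulRightL ℝ E E (innerSL ℝ q) q :=
      (ContinuousLinearMap.smulRightL ℝ E E).isBoundedBilinearMap.continuous.comp
        ((innerSL ℝ).continuous.prodMk continuous_id)
    convert! h1 using 2 with q
  exact hc.comp_stronglyMeasurable ha

namespace Peridynamics
namespace Model

variable {n : ℕ} (M : Model n)

lemma D_subset : M.D ⊆ M.Ω := sdiff_subset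

instance isFiniteMeasure_vol : IsFiniteMeasure M.vol := by
  have := M.bounded_Ω.measure_lt_top (μ := volume)
  exact ⟨by simpa [vol] using this⟩

instance isFiniteMeasure_restrict_D : IsFiniteMeasure (volume.restrict M.D) :=
  ⟨by
    rw [Measure.restrict_apply_univ]
    exact (measure_mono M.D_subset).trans_lt (M.bounded_Ω.measure_lt_top (μ := volume))⟩

lemma vol_restrict_D : M.vol.restrict M.D = volume.restrict M.D := by
  rw [vol, Measure.restrict_restrict M.measurableSet_D, inter_eq_left.2 M.D_subset]

lemma ae_D_iff {p : Space n → Prop} :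
    (∀ᵐ x ∂volume.restrict M.D, p x) ↔ ∀ᵐ x ∂M.vol, x ∈ M.D → p x := by
  rw [← M.vol_restrict_D, ae_restrict_iff' M.measurableSet_D]

/-- The scalar `χ J^ε / (ε^{n+1} ω_n |y-x|) g''(√|y-x| S(y, x, u))` by which the bond `(y, x)`
enters the linearization at `u`. -/
def stiffness (S : BondSet n) (u : Space n → Space n) (x y : Space n) : ℝ :=
  intact S y x * M.weight y x / ‖y - x‖ * iteratedDeriv 2 M.g (√‖y - x‖ * strain y x u)

lemma measurable_stiffness (S : BondSet n) {u : Space n → Space n} (hu : Measurable u) :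
    Measurable fun p : Space n × Space n => M.stiffness S u p.1 p.2 := by
  have h : Measurable fun p : Space n × Space n => M.stiffness S u p.2 p.1 := by
    have h2 := measurable_strain hu
    have h3 := measurable_intact S
    have h4 := M.measurable_weight
    have h5 := M.measurable_ddg
    unfold stiffness; fun_prop
  exact h.comp measurable_swap

lemma exists_abs_stiffness_le (S : BondSet n) (u : Space n → Space n) :
    ∃ C, 0 ≤ C ∧ ∀ x y, |M.stiffness S u x y| ≤ C * ‖y - x‖⁻¹ := by
  obtain ⟨W, hW0, hW⟩ := M.exists_weight_le
  obtain ⟨G, hG⟩ := M.bounded_g 2 (by norm_num)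
  have hG0 : 0 ≤ G := (abs_nonneg _).trans (hG 0)
  refine ⟨1 * W * G, by positivity, fun x y => ?_⟩
  rw [stiffness, abs_mul, abs_div, abs_mul, abs_norm, div_eq_mul_inv]
  calc _ ≤ 1 * W * ‖y - x‖⁻¹ * G := by
        gcongr
        · exact abs_intact_le S y x
        · exact hW y x
        · exact hG _
    _ = _ := by ring

/-- The rank one operator `stiffness • e ⊗ e`, with `e = e_{y-x}`. -/
def bondTensor (S : BondSet n) (u : Space n → Space n) (x y : Space n) :
    Space n →L[ℝ] Space n :=
  M.stiffness S u x y • InnerProductSpace.rankOne ℝ (bondDir y x) (bondDir y x)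

lemma bondTensor_apply (S : BondSet n) (u : Space n → Space n) (x y v : Space n) :
    M.bondTensor S u x y v =
      (M.stiffness S u x y * inner ℝ (bondDir y x) v) • bondDir y x := by
  rw [bondTensor, smul_apply, InnerProductSpace.rankOne_apply, smul_smul]

lemma measurable_bondDir_swap : Measurable fun p : Space n × Space n => bondDir p.2 p.1 := by
  unfold bondDir; fun_prop

lemma stronglyMeasurable_bondTensor (S : BondSet n) {u : Space n → Space n} (hu : Measurable u) :
    StronglyMeasurable fun p : Space n × Space n => M.bondTensor S u p.1 p.2 :=
  (M.measurable_stiffness S hu).stronglyMeasurable.smul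
    (stronglyMeasurable_rankOne measurable_bondDir_swap.stronglyMeasurable)

lemma exists_norm_bondTensor_le (S : BondSet n) (u : Space n → Space n) :
    ∃ C, 0 ≤ C ∧ ∀ x y, ‖M.bondTensor S u x y‖ ≤ C * ‖y - x‖⁻¹ := by
  obtain ⟨C, hC0, hC⟩ := M.exists_abs_stiffness_le S u
  refine ⟨C, hC0, fun x y => ?_⟩
  rw [bondTensor, norm_smul, Real.norm_eq_abs, InnerProductSpace.norm_rankOne]
  calc _ ≤ C * ‖y - x‖⁻¹ * (1 * 1) := by
        gcongr
        · exact hC x y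
        · exact norm_bondDir_le y x
        · exact norm_bondDir_le y x
    _ = _ := by ring

lemma integrableOn_bondTensor (S : BondSet n) {u : Space n → Space n} (hu : Measurable u)
    (x : Space n) : IntegrableOn (M.bondTensor S u x) (Metric.ball x M.ε ∩ M.Ω) := by
  obtain ⟨C, -, hC⟩ := M.exists_norm_bondTensor_le S u
  exact Integrable.mono' ((M.integrableOn_inv_norm x).const_mul C)
    ((M.stronglyMeasurable_bondTensor S hu).comp_measurable
      measurable_prodMk_left).aestronglyMeasurable (Eventually.of_forall fun y => hC x y)

lemma toEuclideanCLM_stabilityTensor (S : BondSet n) {u : Space n → Space n} (hu : Measurable u)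
    (x : Space n) : Matrix.toEuclideanCLM (𝕜 := ℝ) (M.stabilityTensor S u x) =
      ∫ y in Metric.ball x M.ε ∩ M.Ω, M.bondTensor S u x y := by
  have hint := M.integrableOn_bondTensor S hu x
  ext v i
  rw [ContinuousLinearMap.integral_apply hint]
  have h1 := (EuclideanSpace.proj i : Space n →L[ℝ] ℝ).integral_comp_comm
    (hint.apply_continuousLinearMap v)
  simp only [PiLp.proj_apply] at h1
  rw [← h1]
  have h2 : ∀ j, Integrable (fun y => M.stiffness S u x y * (bondDir y x i * bondDir y x j))
      (volume.restrict (Metric.ball x M.ε ∩ M.Ω)) := fun j => by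
    have h3 := (EuclideanSpace.proj i : Space n →L[ℝ] ℝ).integrable_comp
      (hint.apply_continuousLinearMap (EuclideanSpace.single j 1))
    refine h3.congr (Eventually.of_forall fun y => ?_)
    simp [bondTensor_apply, EuclideanSpace.inner_single_right]
    ring
  have h4 : (Matrix.toEuclideanCLM (𝕜 := ℝ) (M.stabilityTensor S u x) v) i =
      ∑ j, (∫ y in Metric.ball x M.ε ∩ M.Ω,
        M.stiffness S u x y * (bondDir y x i * bondDir y x j)) * v j := by
    rfl
  rw [h4]
  simp only [← integral_mul_const]
  rw [← integral_finsetSum _ fun j _ => (h2 j).mul_const _]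
  refine integral_congr_ae (Eventually.of_forall fun y => ?_)
  simp only [bondTensor_apply, PiLp.smul_apply, smul_eq_mul, PiLp.inner_apply, Finset.mul_sum,
    Finset.sum_mul]
  refine Finset.sum_congr rfl fun j _ => ?_
  simp
  ring

lemma measurable_integral_near {F : Space n → Space n → ℝ}
    (hF : Measurable fun p : Space n × Space n => F p.1 p.2) :
    Measurable fun x => ∫ y in Metric.ball x M.ε ∩ M.Ω, F x y := by
  have hs : MeasurableSet {p : Space n × Space n | dist p.2 p.1 < M.ε} :=
    measurableSet_lt (by fun_prop) measurable_const
  have key : (fun x => ∫ y in Metric.ball x M.ε ∩ M.Ω, F x y) = fun x =>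
      ∫ y in M.Ω, ({p : Space n × Space n | dist p.2 p.1 < M.ε}.indicator
        (fun p => F p.1 p.2)) (x, y) := by
    funext x
    rw [inter_comm, ← setIntegral_indicator measurableSet_ball]
    rfl
  rw [key]
  exact (hF.indicator hs).stronglyMeasurable.integral_prod_right'.measurable

lemma measurable_stabilityTensor (S : BondSet n) {u : Space n → Space n} (hu : Measurable u)
    (i j : Fin n) : Measurable fun x => M.stabilityTensor S u x i j := by
  have h1 := measurable_bondDir_swap (n := n)
  have h2 := M.measurable_stiffness S hu
  exact M.measurable_integral_near
    (F := fun x y => M.stiffness S u x y * (bondDir y x i * bondDir y x j)) (by fun_prop)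

lemma isSymm_stabilityTensor (S : BondSet n) (u : Space n → Space n) (x : Space n) :
    (M.stabilityTensor S u x)ᵀ = M.stabilityTensor S u x := by
  ext i j
  simp only [Matrix.transpose_apply, stabilityTensor, Matrix.of_apply]
  congr 1
  funext y
  rw [mul_comm (bondDir y x j)]

/-- The inverse of the stability tensor, as an operator; zero where the tensor is singular. -/
def invStability (S : BondSet n) (u : Space n → Space n) (x : Space n) : Space n →L[ℝ] Space n :=
  Matrix.toEuclideanCLM (𝕜 := ℝ) (M.stabilityTensor S u x)⁻¹

lemma stronglyMeasurable_invStability (S : BondSet n) {u : Space n → Space n}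
    (hu : Measurable u) : StronglyMeasurable (M.invStability S u) := by
  have hm : Measurable fun x => (fun i j => M.stabilityTensor S u x i j : Fin n → Fin n → ℝ) :=
    measurable_pi_iff.2 fun i => measurable_pi_iff.2 fun j => M.measurable_stabilityTensor S hu i j
  have hdet : Continuous fun a : Fin n → Fin n → ℝ => (Matrix.of a).det :=
    Continuous.matrix_det continuous_id
  have hadj : Continuous fun a : Fin n → Fin n → ℝ => (Matrix.of a).adjugate :=
    Continuous.matrix_adjugate continuous_id
  have hinv : Measurable fun x => (fun i j => (M.stabilityTensor S u x)⁻¹ i j :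
      Fin n → Fin n → ℝ) := by
    refine measurable_pi_iff.2 fun i => measurable_pi_iff.2 fun j => ?_
    have h1 : Measurable fun x => (M.stabilityTensor S u x).det := hdet.measurable.comp hm
    have h2 : Measurable fun x => (M.stabilityTensor S u x).adjugate i j :=
      ((continuous_apply j).comp ((continuous_apply i).comp hadj)).measurable.comp hm
    simp only [Matrix.inv_def, Matrix.smul_apply, Ring.inverse_eq_inv', smul_eq_mul]
    exact h1.inv.mul h2
  have hcont : Continuous fun a : Fin n → Fin n → ℝ =>
      Matrix.toEuclideanCLM (𝕜 := ℝ) (Matrix.of a) :=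
    ((Matrix.toEuclideanCLM (𝕜 := ℝ) (n := Fin n)).toAlgEquiv.toLinearMap ∘ₗ
      (Matrix.ofLinearEquiv ℝ).toLinearMap).continuous_of_finiteDimensional
  exact hcont.comp_stronglyMeasurable hinv.stronglyMeasurable

/-- Since `𝔸` is symmetric, `𝔸² > γ²` means `|𝔸 v| > γ |v|`, which makes `𝔸` invertible with
`|𝔸⁻¹| ≤ 1 / γ`. -/
lemma norm_invStability_le_and_rightInverse {S : BondSet n} {u : Space n → Space n} {γ : ℝ}
    (hγ : 0 < γ) (h : M.StabilityAbove S u γ) : ∀ᵐ x ∂volume.restrict M.D,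
      ‖M.invStability S u x‖ ≤ γ⁻¹ ∧
      ∀ v, Matrix.toEuclideanCLM (𝕜 := ℝ) (M.stabilityTensor S u x)
        (M.invStability S u x v) = v := by
  rw [M.ae_D_iff]
  filter_upwards [h] with x hx hD
  set A := M.stabilityTensor S u x with hA
  have hsq : ∀ v : Fin n → ℝ, ((A * A) *ᵥ v) ⬝ᵥ v = (A *ᵥ v) ⬝ᵥ (A *ᵥ v) := fun v => by
    rw [← Matrix.mulVec_mulVec, dotProduct_comm, Matrix.dotProduct_mulVec,
      ← Matrix.mulVec_transpose, M.isSymm_stabilityTensor]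
  have hpos := fun v hv => (hx hD v hv).trans_eq (hsq v)
  have hunit : IsUnit A.det := by
    rw [isUnit_iff_ne_zero]
    intro hdet
    obtain ⟨v, hv, hAv⟩ := Matrix.exists_mulVec_eq_zero_iff.2 hdet
    have h1 := hpos v hv
    rw [hAv, dotProduct_zero] at h1
    have h2 : 0 ≤ v ⬝ᵥ v := dotProduct_self_star_nonneg v
    nlinarith [sq_nonneg γ]
  have hright : ∀ v, Matrix.toEuclideanCLM (𝕜 := ℝ) A (M.invStability S u x v) = v := fun v => by
    rw [invStability, ← mul_apply_eq_comp, ← map_mul, Matrix.mul_nonsing_inv _ hunit, map_one,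
      one_apply_eq_self]
  have hnorm : ∀ v : Space n, γ * ‖v‖ ≤ ‖Matrix.toEuclideanCLM (𝕜 := ℝ) A v‖ := fun v => by
    rcases eq_or_ne v 0 with rfl | hv
    · simp
    have h1 := hpos v.ofLp (by simpa using hv)
    have h2 : ∀ z : Space n, ‖z‖ ^ 2 = z.ofLp ⬝ᵥ z.ofLp := fun z => by
      rw [EuclideanSpace.real_norm_sq_eq]
      exact Finset.sum_congr rfl fun i _ => sq _
    refine le_of_sq_le_sq ?_ (norm_nonneg _)
    rw [mul_pow, h2, h2]
    exact h1.le
  refine ⟨ContinuousLinearMap.opNorm_le_bound _ (by positivity) fun v => ?_, hright⟩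
  have h1 := hnorm (M.invStability S u x v)
  rw [hright] at h1
  rwa [inv_mul_eq_div, le_div_iff₀ hγ, mul_comm]

end Model
end Peridynamics

/-! ### The linearization as a weakly singular integral operator -/

namespace Peridynamics
namespace Model
open IntegralOperator

variable {n : ℕ} (M : Model n)

/-- The kernel `(x, y) ↦ B(x) ∘ bondTensor(x, y)`, restricted to the bonds whose length lies
in `s`. -/
def bondKernel (S : BondSet n) (u : Space n → Space n) (B : Space n → Space n →L[ℝ] Space n)
    (s : Set ℝ) (x y : Space n) : Space n →L[ℝ] Space n :=
  s.indicator (fun _ => (1 : ℝ)) ‖y - x‖ • B x ∘L M.bondTensor S u x y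

lemma stronglyMeasurable_bondKernel (S : BondSet n) {u : Space n → Space n} (hu : Measurable u)
    {B : Space n → Space n →L[ℝ] Space n} (hB : StronglyMeasurable B) {s : Set ℝ}
    (hs : MeasurableSet s) :
    StronglyMeasurable fun p : Space n × Space n => M.bondKernel S u B s p.1 p.2 := by
  have h1 : Measurable fun p : Space n × Space n => s.indicator (fun _ => (1 : ℝ)) ‖p.2 - p.1‖ :=
    (measurable_const.indicator hs).comp (by fun_prop : Measurable fun p : Space n × Space n =>
      ‖p.2 - p.1‖)
  have h2 := (isBoundedBilinearMap_comp (𝕜 := ℝ) (E := Space n) (F := Space n)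
    (G := Space n)).continuous.comp_stronglyMeasurable
      ((hB.comp_measurable measurable_fst).prodMk (M.stronglyMeasurable_bondTensor S hu))
  exact h1.stronglyMeasurable.smul h2

/-- The kernel has a singularity `1 / |y - x|`, uniformly in `B` with `|B| ≤ b`. -/
lemma exists_norm_bondKernel_le (S : BondSet n) (u : Space n → Space n) (b : ℝ) (hb : 0 ≤ b) :
    ∃ C, 0 ≤ C ∧ ∀ (B : Space n → Space n →L[ℝ] Space n), (∀ x, ‖B x‖ ≤ b) →
      ∀ s x y, ‖M.bondKernel S u B s x y‖ ≤
        C * s.indicator (fun _ => (1 : ℝ)) ‖y - x‖ * ‖y - x‖⁻¹ := by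
  obtain ⟨C, hC0, hC⟩ := M.exists_norm_bondTensor_le S u
  refine ⟨b * C, by positivity, fun B hB s x y => ?_⟩
  have h0 : 0 ≤ s.indicator (fun _ => (1 : ℝ)) ‖y - x‖ :=
    indicator_nonneg (fun _ _ => zero_le_one) _
  rw [bondKernel, norm_smul, Real.norm_of_nonneg h0]
  calc _ ≤ s.indicator (fun _ => (1 : ℝ)) ‖y - x‖ * (b * (C * ‖y - x‖⁻¹)) := by
        gcongr
        refine (ContinuousLinearMap.opNorm_comp_le _ _).trans ?_
        gcongr
        · exact hB x
        · exact hC x y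
    _ = _ := by ring

lemma lintegral_inv_norm_ball_lt_top :
    ∫⁻ z in Metric.ball (0 : Space n) M.ε, ‖z‖ₑ⁻¹ < ∞ := by
  have h := (M.integrableOn_inv_norm_ball 0).2
  simp only [sub_zero] at h
  refine lt_of_le_of_lt (le_of_eq ?_) h
  have hn : 2 ≤ n := by rcases M.dim with h | h <;> omega
  have : Nonempty (Fin n) := ⟨⟨0, by omega⟩⟩
  refine lintegral_congr_ae ?_
  filter_upwards [ae_restrict_of_ae (Measure.ae_ne volume (0 : Space n))] with z hz
  rw [enorm_inv (norm_ne_zero_iff.2 hz), enorm_norm]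

/-- Short bonds contribute little: the integral of `1/|z|` over a small ball is small. -/
lemma exists_lintegral_inv_norm_ball_le {c : ℝ≥0∞} (hc : c ≠ 0) :
    ∃ r, 0 < r ∧ r ≤ M.ε ∧ ∫⁻ z in Metric.ball (0 : Space n) r, ‖z‖ₑ⁻¹ ≤ c := by
  obtain ⟨δ, hδ, h⟩ := exists_pos_setLIntegral_lt_of_measure_lt
    M.lintegral_inv_norm_ball_lt_top.ne hc
  have hn : 2 ≤ n := by rcases M.dim with h | h <;> omega
  have : Nonempty (Fin n) := ⟨⟨0, by omega⟩⟩
  have htend : Tendsto (fun r : ℝ => ENNReal.ofReal (r ^ n) *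
      volume (Metric.ball (0 : Space n) 1)) (𝓝[>] 0) (𝓝 0) := by
    have h1 : Tendsto (fun r : ℝ => ENNReal.ofReal (r ^ n)) (𝓝[>] 0) (𝓝 0) := by
      have : Tendsto (fun r : ℝ => r ^ n) (𝓝[>] 0) (𝓝 0) :=
        tendsto_nhdsWithin_of_tendsto_nhds
          ((continuous_pow n).tendsto' 0 0 (zero_pow (by omega)))
      simpa using ENNReal.tendsto_ofReal this
    have h2 := ENNReal.Tendsto.mul_const h1
      (Or.inr (measure_ball_lt_top (μ := volume) (x := (0 : Space n)) (r := 1)).ne)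
    rwa [zero_mul] at h2
  obtain ⟨r, hr, hr0, hrε⟩ := ((htend.eventually (gt_mem_nhds hδ)).and
    (Ioo_mem_nhdsGT M.ε_pos)).exists
  refine ⟨r, hr0, hrε.le, ?_⟩
  have hvol : volume.restrict (Metric.ball (0 : Space n) M.ε) (Metric.ball 0 r) < δ := by
    refine (Measure.restrict_apply_le _ _).trans_lt ?_
    rw [Measure.addHaar_ball volume (0 : Space n) hr0.le, finrank_euclideanSpace_fin]
    exact hr
  have := (h _ hvol).le
  rwa [Measure.restrict_restrict measurableSet_ball,
    inter_eq_left.2 (Metric.ball_subset_ball hrε.le)] at this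

/-- Kernels with singularity `1/|x-y|` satisfy Schur's test. -/
lemma schurBound_of_norm_le_inv_norm {k : Space n → Space n → Space n →L[ℝ] Space n}
    (hk : StronglyMeasurable fun p : Space n × Space n => k p.1 p.2) {C r : ℝ} {c : NNReal}
    (hC : ∀ x y, ‖k x y‖ ≤ C * (Iio r).indicator (fun _ => (1 : ℝ)) ‖y - x‖ * ‖y - x‖⁻¹)
    (hc : ENNReal.ofReal C * ∫⁻ z in Metric.ball (0 : Space n) r, ‖z‖ₑ⁻¹ ≤ c) :
    SchurBound (volume.restrict M.D) k c := by
  set φ : Space n → ℝ≥0∞ := fun z =>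
    ENNReal.ofReal C * (Metric.ball (0 : Space n) r).indicator (fun z => ‖z‖ₑ⁻¹) z with hφ
  have hφint : ∫⁻ z, φ z = ENNReal.ofReal C * ∫⁻ z in Metric.ball (0 : Space n) r, ‖z‖ₑ⁻¹ := by
    rw [lintegral_const_mul' _ _ ENNReal.ofReal_ne_top, lintegral_indicator measurableSet_ball]
  have hle : ∀ x y, ‖k x y‖ₑ ≤ φ (y - x) := fun x y => by
    have h1 : ‖k x y‖ₑ ≤ ENNReal.ofReal
        (C * (Iio r).indicator (fun _ => (1 : ℝ)) ‖y - x‖ * ‖y - x‖⁻¹) := by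
      rw [← ofReal_norm]
      exact ENNReal.ofReal_le_ofReal (hC x y)
    refine h1.trans ?_
    by_cases hr : ‖y - x‖ < r
    · have hmem : y - x ∈ Metric.ball (0 : Space n) r := by simpa using hr
      simp only [hφ, indicator_of_mem hmem, indicator_of_mem (mem_Iio.2 hr), mul_one]
      rw [ENNReal.ofReal_mul' (by positivity)]
      gcongr
      rw [← ofReal_norm]
      exact ENNReal.ofReal_inv_le
    · rw [indicator_of_notMem (by simpa using hr)]
      simp
  have hφneg : ∀ z, φ (-z) = φ z := fun z => by
    simp only [hφ]
    by_cases hz : z ∈ Metric.ball (0 : Space n) r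
    · have hz' : -z ∈ Metric.ball (0 : Space n) r := by simpa using hz
      rw [indicator_of_mem hz, indicator_of_mem hz', enorm_neg]
    · have hz' : -z ∉ Metric.ball (0 : Space n) r := by simpa using hz
      rw [indicator_of_notMem hz, indicator_of_notMem hz']
  refine ⟨hk, fun x => ?_, fun y => ?_⟩
  · calc _ ≤ ∫⁻ y, φ (y - x) :=
        (setLIntegral_le_lintegral _ _).trans (lintegral_mono fun y => hle x y)
      _ = ∫⁻ z, φ z := lintegral_sub_right_eq_self φ x
      _ ≤ c := hφint.trans_le hc
  · calc _ ≤ ∫⁻ x, φ (y - x) :=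
        (setLIntegral_le_lintegral _ _).trans (lintegral_mono fun x => hle x y)
      _ = ∫⁻ x, φ (x - y) := lintegral_congr fun x => by rw [← neg_sub, hφneg]
      _ = ∫⁻ z, φ z := lintegral_sub_right_eq_self φ y
      _ ≤ c := hφint.trans_le hc

lemma linFun_congr (S : BondSet n) (u : Space n → Space n) {w w' : Space n → Space n}
    (h : w =ᵐ[M.vol] w') : M.linFun S u w =ᵐ[M.vol] M.linFun S u w' := by
  filter_upwards [h] with x hx
  by_cases hD : x ∈ M.D
  · simp only [linFun, indicator_of_mem hD]
    congr 1
    refine integral_congr_ae ?_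
    filter_upwards [M.ae_near h x] with y hy
    simp only [linIntegrand, strain_congr hy hx]
  · simp [linFun, hD]

/-- The structure of the linearization: it is twice the stability tensor minus an integral operator
with a weakly singular kernel. -/
lemma ae_linFun_indicator_eq (S : BondSet n) {u : Space n → Space n} (hu : Measurable u)
    {w : Space n → Space n} (hw : MemLp w 2 (volume.restrict M.D)) :
    ∀ᵐ x ∂volume.restrict M.D, M.linFun S u (M.D.indicator w) x =
      (2 : ℝ) • Matrix.toEuclideanCLM (𝕜 := ℝ) (M.stabilityTensor S u x) (w x) -
        (2 : ℝ) • IntegralOperator.apply (volume.restrict M.D)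
          (M.bondKernel S u (fun _ => ContinuousLinearMap.id ℝ (Space n)) (Iio M.ε)) w x := by
  obtain ⟨C, hC0, hC⟩ := M.exists_norm_bondKernel_le S u 1 zero_le_one
  have hk := M.stronglyMeasurable_bondKernel S hu
    (stronglyMeasurable_const (b := ContinuousLinearMap.id ℝ (Space n)))
    (measurableSet_Iio (a := M.ε))
  have hfin : ENNReal.ofReal C * ∫⁻ z in Metric.ball (0 : Space n) M.ε, ‖z‖ₑ⁻¹ ≠ ∞ :=
    ENNReal.mul_ne_top ENNReal.ofReal_ne_top M.lintegral_inv_norm_ball_lt_top.ne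
  have hsb := M.schurBound_of_norm_le_inv_norm hk
    (hC _ (fun _ => ContinuousLinearMap.norm_id_le) (Iio M.ε)) (ENNReal.coe_toNNReal hfin).ge
  filter_upwards [hsb.ae_integrable hw, ae_restrict_mem M.measurableSet_D] with x hx hD
  have hball : Metric.ball x M.ε = (fun y => ‖y - x‖) ⁻¹' Iio M.ε := by
    ext y; simp [dist_eq_norm]
  -- the kernel of the integral operator, as a function on `ball x ε ∩ Ω`
  have hker : ∀ y, M.D.indicator (fun y => M.bondKernel S u
      (fun _ => ContinuousLinearMap.id ℝ (Space n)) (Iio M.ε) x y (w y)) y =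
      (Metric.ball x M.ε ∩ M.Ω).indicator
        (fun y => M.bondTensor S u x y (M.D.indicator w y)) y := fun y => by
    by_cases hy : y ∈ M.D
    · have hyΩ : y ∈ M.Ω := M.D_subset hy
      by_cases hyb : y ∈ Metric.ball x M.ε
      · have h1 : ‖y - x‖ ∈ Iio M.ε := by rwa [hball] at hyb
        rw [indicator_of_mem hy, indicator_of_mem
          (show y ∈ Metric.ball x M.ε ∩ M.Ω from ⟨hyb, hyΩ⟩), indicator_of_mem hy, bondKernel,
          indicator_of_mem h1, one_smul]
        rfl
      · have h1 : ‖y - x‖ ∉ Iio M.ε := by rwa [hball] at hyb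
        rw [indicator_of_mem hy, indicator_of_notMem (fun h => hyb h.1), bondKernel,
          indicator_of_notMem h1]
        simp
    · rw [indicator_of_notMem hy]
      by_cases hyb : y ∈ Metric.ball x M.ε ∩ M.Ω
      · rw [indicator_of_mem hyb, indicator_of_notMem hy, map_zero]
      · rw [indicator_of_notMem hyb]
  have hms : MeasurableSet (Metric.ball x M.ε ∩ M.Ω) :=
    measurableSet_ball.inter M.isOpen_Ω.measurableSet
  have hint1 : IntegrableOn (fun y => M.bondTensor S u x y (M.D.indicator w y))
      (Metric.ball x M.ε ∩ M.Ω) := by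
    rw [← integrable_indicator_iff hms]
    refine Integrable.congr ((integrable_indicator_iff M.measurableSet_D).2 hx)
      (Eventually.of_forall hker)
  have hint2 : IntegrableOn (fun y => M.bondTensor S u x y (w x)) (Metric.ball x M.ε ∩ M.Ω) :=
    (M.integrableOn_bondTensor S hu x).apply_continuousLinearMap (w x)
  rw [IntegralOperator.apply, ← integral_indicator M.measurableSet_D,
    integral_congr_ae (Eventually.of_forall hker), integral_indicator hms,
    M.toEuclideanCLM_stabilityTensor S hu, ContinuousLinearMap.integral_apply
      (M.integrableOn_bondTensor S hu x), ← smul_sub, ← integral_sub hint2 hint1, linFun,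
    indicator_of_mem hD, ← integral_neg, ← integral_smul]
  refine integral_congr_ae (Eventually.of_forall fun y => ?_)
  have hst : strain y x (M.D.indicator w) = ‖y - x‖⁻¹ *
      (inner ℝ (bondDir y x) (M.D.indicator w y) - inner ℝ (bondDir y x) (w x)) := by
    rw [strain, real_inner_smul_left, indicator_of_mem hD, real_inner_comm, inner_sub_right]
  simp only [linIntegrand, bondTensor_apply, hst, stiffness]
  rw [← sub_smul, smul_smul, ← neg_smul]
  congr 1
  ring

end Model
end Peridynamics

/-! ### Invertibility of the linearization -/

namespace Peridynamics
namespace Model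
open IntegralOperator

variable {n : ℕ} (M : Model n)

lemma isClosed_V : IsClosed (M.V : Set M.Linf) := by
  refine IsSeqClosed.isClosed fun f v hf hv => ?_
  obtain ⟨ns, -, hns⟩ := (tendstoInMeasure_of_tendsto_Lp hv).exists_seq_tendsto_ae
  have hf' : ∀ i, ∀ᵐ x ∂M.vol, x ∈ M.Ωd → f i x = 0 := hf
  change ∀ᵐ x ∂M.vol, x ∈ M.Ωd → v x = 0
  filter_upwards [hns, ae_all_iff.2 hf'] with x hx hfx hxd
  refine tendsto_nhds_unique hx ?_
  simp only [hfx _ hxd]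
  exact tendsto_const_nhds

instance completeSpace_V : CompleteSpace M.V := M.isClosed_V.completeSpace_coe

lemma ae_eq_zero_of_notMem_D (v : M.V) : ∀ᵐ x ∂M.vol, x ∉ M.D → (v : M.Linf) x = 0 := by
  have hv : ∀ᵐ x ∂M.vol, x ∈ M.Ωd → (v : M.Linf) x = 0 := v.2
  filter_upwards [hv, ae_restrict_mem M.isOpen_Ω.measurableSet] with x hx hΩ hD
  exact hx (by_contra fun h => hD ⟨hΩ, h⟩)

/-- Every square integrable displacement that vanishes off `D` is an `L²`-limit of elements
of `𝒱`. -/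
lemma toLp_mem_VclosureL2 {w : Space n → Space n} (hw : MemLp (M.D.indicator w) 2 M.vol) :
    hw.toLp _ ∈ M.VclosureL2 := by
  refine EMetric.mem_closure_iff.2 fun ε hε => ?_
  obtain ⟨g, hg, -⟩ := hw.exists_simpleFunc_eLpNorm_sub_lt ENNReal.ofNat_ne_top hε.ne'
  have hg2 : MemLp (M.D.indicator g) 2 M.vol :=
    (g.memLp_of_isFiniteMeasure 2 M.vol).indicator M.measurableSet_D
  have hgtop : MemLp (M.D.indicator g) ∞ M.vol :=
    (g.memLp_top M.vol).indicator M.measurableSet_D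
  refine ⟨hg2.toLp _, ⟨hgtop.toLp _, M.toLp_mem_V hgtop,
    hg2.coeFn_toLp.trans hgtop.coeFn_toLp.symm⟩, ?_⟩
  rw [Lp.edist_toLp_toLp]
  refine lt_of_le_of_lt (eLpNorm_mono fun x => ?_) hg
  by_cases hD : x ∈ M.D
  · simp [hD]
  · simp [hD]

lemma memLp_two (v : M.Linf) : MemLp v 2 M.vol := (Lp.memLp v).mono_exponent le_top

lemma lin_injective {S : BondSet n} {u : M.Linf} (hker : M.TrivialKernelL2 S u) :
    Function.Injective (M.lin S u) := by
  refine (injective_iff_map_eq_zero _).2 fun v hv => ?_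
  have h1 : M.linFun S u v =ᵐ[M.vol] 0 := by
    refine (M.coe_lin S u v).symm.trans ?_
    rw [hv]
    exact Lp.coeFn_zero _ _ _
  have h2 := (M.memLp_two v).coeFn_toLp
  have h3 := hker ((M.memLp_two v).toLp _) (subset_closure ⟨v, v.2, h2⟩)
    ((M.linFun_congr S u h2).trans h1)
  have h4 : (v : M.Linf) =ᵐ[M.vol] (0 : Space n → Space n) :=
    h2.symm.trans ((Lp.eq_zero_iff_ae_eq_zero).1 h3)
  exact Subtype.ext ((Lp.eq_zero_iff_ae_eq_zero).2 h4)

/-- Surjectivity by the Fredholm alternative: with `L` the integral operator in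
`ℒ'[u] w = 2 𝔸 w - 2 L w` and `B = 𝔸⁻¹`, the equation `ℒ'[u] w = f` on `D` reads
`w = B f / 2 + B L w`. -/
lemma lin_surjective {S : BondSet n} {u : M.Linf} {γ : ℝ} (hγ : 0 < γ)
    (hstab : M.StabilityAbove S u γ) (hker : M.TrivialKernelL2 S u) :
    Function.Surjective (M.lin S u) := by
  have hu := M.measurable_rep u
  set μ := volume.restrict M.D with hμ
  -- the inverse stability tensor, cut off where it is not bounded by `1 / γ`
  have hBm := M.stronglyMeasurable_invStability S hu
  set G : Set (Space n) := {x | ‖M.invStability S u x‖ ≤ γ⁻¹} with hG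
  have hGm : MeasurableSet G := measurableSet_le hBm.norm.measurable measurable_const
  set B : Space n → Space n →L[ℝ] Space n := G.indicator (M.invStability S u) with hB
  have hBsm : StronglyMeasurable B := hBm.indicator hGm
  have hBle : ∀ x, ‖B x‖ ≤ γ⁻¹ := fun x => by
    by_cases hx : x ∈ G
    · rw [hB, indicator_of_mem hx]
      exact hx
    · rw [hB, indicator_of_notMem hx, norm_zero]
      positivity
  have hAB : ∀ᵐ x ∂μ, ∀ v,
      Matrix.toEuclideanCLM (𝕜 := ℝ) (M.stabilityTensor S u x) (B x v) = v := by
    filter_upwards [M.norm_invStability_le_and_rightInverse hγ hstab] with x hx v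
    rw [hB, indicator_of_mem (show x ∈ G from hx.1), hx.2]
  -- near and far part of the kernel
  obtain ⟨C, hC0, hC⟩ := M.exists_norm_bondKernel_le S u γ⁻¹ (by positivity)
  obtain ⟨r, hr0, hrε, hr⟩ := M.exists_lintegral_inv_norm_ball_le
    (c := ENNReal.ofReal (1 / (2 * (C + 1)))) (by
      rw [Ne, ENNReal.ofReal_eq_zero, not_le]; positivity)
  have hnear : SchurBound μ (M.bondKernel S u B (Iio r)) (1 / 2) := by
    refine M.schurBound_of_norm_le_inv_norm
      (M.stronglyMeasurable_bondKernel S hu hBsm measurableSet_Iio) (hC B hBle (Iio r)) ?_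
    calc _ ≤ ENNReal.ofReal C * ENNReal.ofReal (1 / (2 * (C + 1))) := by gcongr
      _ = ENNReal.ofReal (C * (1 / (2 * (C + 1)))) := (ENNReal.ofReal_mul hC0).symm
      _ ≤ ENNReal.ofReal ((1 / 2 : NNReal) : ℝ) := by
          refine ENNReal.ofReal_le_ofReal ?_
          push_cast
          rw [mul_one_div, div_le_div_iff₀ (by positivity) two_pos]
          linarith
      _ = _ := ENNReal.ofReal_coe_nnreal
  set R : NNReal := (C * r⁻¹).toNNReal with hR
  have hfarle : ∀ x y, ‖M.bondKernel S u B (Ico r M.ε) x y‖ ≤ R := fun x y => by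
    refine (hC B hBle _ x y).trans ?_
    rw [hR, Real.coe_toNNReal _ (by positivity), mul_assoc]
    gcongr
    by_cases hs : ‖y - x‖ ∈ Ico r M.ε
    · rw [indicator_of_mem hs, one_mul]
      exact inv_anti₀ hr0 hs.1
    · rw [indicator_of_notMem hs, zero_mul]
      positivity
  have hfar : SchurBound μ (M.bondKernel S u B (Ico r M.ε)) (R * (μ univ).toNNReal) :=
    schurBound_of_norm_le
      (M.stronglyMeasurable_bondKernel S hu hBsm measurableSet_Ico) hfarle
  obtain ⟨C', hC'0, hC'⟩ := M.exists_norm_bondKernel_le S u 1 zero_le_one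
  have hfull := M.schurBound_of_norm_le_inv_norm
    (M.stronglyMeasurable_bondKernel S hu
      (stronglyMeasurable_const (b := ContinuousLinearMap.id ℝ (Space n)))
      (measurableSet_Iio (a := M.ε)))
    (hC' _ (fun _ => ContinuousLinearMap.norm_id_le) (Iio M.ε))
    (ENNReal.coe_toNNReal (ENNReal.mul_ne_top ENNReal.ofReal_ne_top
      M.lintegral_inv_norm_ball_lt_top.ne)).ge
  -- equivalence with an equation of the second kind on `D`
  have key : ∀ f w : Space n → Space n, MemLp w 2 μ →
      w =ᵐ[μ] (fun x => (1 / 2 : ℝ) • B x (f x)) +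
        (IntegralOperator.apply μ (M.bondKernel S u B (Iio r)) w +
          IntegralOperator.apply μ (M.bondKernel S u B (Ico r M.ε)) w) →
      M.linFun S u (M.D.indicator w) =ᵐ[M.vol] M.D.indicator f := by
    intro f w hw heq
    have hon : ∀ᵐ x ∂μ, M.linFun S u (M.D.indicator w) x = f x := by
      filter_upwards [heq, M.ae_linFun_indicator_eq S hu hw, hAB, hnear.ae_integrable hw,
        hfar.ae_integrable hw, hfull.ae_integrable hw] with x h1 h2 h3 h4 h5 h6
      set Lw := IntegralOperator.apply μ
        (M.bondKernel S u (fun _ => ContinuousLinearMap.id ℝ (Space n)) (Iio M.ε)) w x with hLw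
      have hsum : IntegralOperator.apply μ (M.bondKernel S u B (Iio r)) w x +
          IntegralOperator.apply μ (M.bondKernel S u B (Ico r M.ε)) w x = B x Lw := by
        rw [hLw, IntegralOperator.apply, IntegralOperator.apply, IntegralOperator.apply,
          ← ContinuousLinearMap.integral_comp_comm _ h6, ← integral_add h4 h5]
        refine integral_congr_ae (Eventually.of_forall fun y => ?_)
        have hind : (Iio M.ε).indicator (fun _ => (1 : ℝ)) ‖y - x‖ =
            (Iio r).indicator (fun _ => (1 : ℝ)) ‖y - x‖ +
              (Ico r M.ε).indicator (fun _ => (1 : ℝ)) ‖y - x‖ := by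
          rw [← Iio_union_Ico_eq_Iio hrε, indicator_union_of_disjoint]
          exact Set.disjoint_left.2 fun z hz hz' => (not_lt.2 hz'.1) hz
        simp only [bondKernel, smul_apply, ContinuousLinearMap.comp_apply, hind,
          ContinuousLinearMap.id_apply, add_smul]
        rw [map_add, map_smul, map_smul]
      rw [h2, h1, Pi.add_apply, Pi.add_apply, hsum, map_add, map_smul, h3, h3, smul_add,
        add_sub_cancel_right, smul_smul]
      norm_num
    filter_upwards [(M.ae_D_iff).1 hon] with x hx
    by_cases hD : x ∈ M.D
    · rw [hx hD, indicator_of_mem hD]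
    · rw [indicator_of_notMem hD, linFun, indicator_of_notMem hD]
  have hind : ∀ {p : ℝ≥0∞} {w : Space n → Space n}, MemLp w p μ →
      MemLp (M.D.indicator w) p M.vol := fun hw => by
    rw [memLp_indicator_iff_restrict M.measurableSet_D, M.vol_restrict_D]
    exact hw
  intro f
  have hfB : MemLp (fun x => (1 / 2 : ℝ) • B x ((f : M.Linf) x)) ∞ μ := by
    have hf : MemLp (f : M.Linf) ∞ μ := by
      rw [hμ, ← M.vol_restrict_D]
      exact (Lp.memLp (f : M.Linf)).restrict M.D
    have hBf : MemLp (fun x => B x ((f : M.Linf) x)) ∞ μ :=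
      hf.of_le_mul (isBoundedBilinearMap_apply.continuous.comp_stronglyMeasurable
        (hBsm.prodMk (M.measurable_rep f).stronglyMeasurable)).aestronglyMeasurable
        (Eventually.of_forall fun x => (B x).le_of_opNorm_le (hBle x) _)
    exact hBf.const_smul (1 / 2 : ℝ)
  have hhom : ∀ w, MemLp w 2 μ → w =ᵐ[μ] IntegralOperator.apply μ (M.bondKernel S u B (Iio r)) w +
      IntegralOperator.apply μ (M.bondKernel S u B (Ico r M.ε)) w → w =ᵐ[μ] 0 := by
    intro w hw heq
    have h1 := key 0 w hw (heq.trans (Eventually.of_forall fun x => by simp))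
    have h2 := hker ((hind hw).toLp _) (M.toLp_mem_VclosureL2 (hind hw))
      ((M.linFun_congr S u (hind hw).coeFn_toLp).trans
        (h1.trans (Eventually.of_forall fun x => by simp)))
    have h3 := (hind hw).coeFn_toLp.symm.trans ((Lp.eq_zero_iff_ae_eq_zero).1 h2)
    refine (M.ae_D_iff).2 ?_
    filter_upwards [h3] with x hx hD
    rwa [indicator_of_mem hD] at hx
  obtain ⟨w, hw, heq⟩ := exists_memLp_top_eq_add_apply hnear hfar hfarle hhom hfB
  refine ⟨⟨(hind hw).toLp _, M.toLp_mem_V (hind hw)⟩, Subtype.ext (Lp.ext ?_)⟩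
  refine (M.coe_lin S u _).trans ((M.linFun_congr S u (hind hw).coeFn_toLp).trans
    ((key f w (hw.mono_exponent le_top) heq).trans ?_))
  filter_upwards [M.ae_eq_zero_of_notMem_D f] with x hx
  by_cases hD : x ∈ M.D
  · rw [indicator_of_mem hD]
  · rw [indicator_of_notMem hD, hx hD]

theorem lin_isInvertible {S : BondSet n} {u : M.Linf} {γ : ℝ} (hγ : 0 < γ)
    (hstab : M.StabilityAbove S u γ) (hker : M.TrivialKernelL2 S u) :
    (M.lin S u).IsInvertible :=
  ⟨ContinuousLinearEquiv.ofBijective (M.lin S u)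
    (LinearMap.ker_eq_bot.2 (M.lin_injective hker))
    (LinearMap.range_eq_top.2 (M.lin_surjective hγ hstab hker)), rfl⟩

end Model
end Peridynamics

/-! ### The load step -/

namespace Peridynamics

lemma exists_pos_mul_lt {a₁ a₂ c₁ c₂ : ℝ} (h₁ : 0 ≤ a₁) (h₂ : 0 ≤ a₂) (hc₁ : 0 < c₁)
    (hc₂ : 0 < c₂) : ∃ δ, 0 < δ ∧ a₁ * δ < c₁ ∧ a₂ * δ < c₂ := by
  have key : ∀ {a c : ℝ}, 0 ≤ a → 0 < c → a * (c / (a + 1)) < c := fun {a c} ha hc => by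
    rw [mul_div_assoc', div_lt_iff₀ (by positivity)]
    nlinarith
  refine ⟨min (c₁ / (a₁ + 1)) (c₂ / (a₂ + 1)), by positivity, ?_, ?_⟩
  · exact (mul_le_mul_of_nonneg_left (min_le_left _ _) h₁).trans_lt (key h₁ hc₁)
  · exact (mul_le_mul_of_nonneg_left (min_le_right _ _) h₂).trans_lt (key h₂ hc₂)

end Peridynamics

end

theorem mainTheorem1 {n : ℕ} (M : Peridynamics.Model n) (u : ℕ → M.Linf) (N : ℕ)
    (vN : M.V) (UN : M.B) (huN : u N = vN + UN)
    (hsol : M.force (M.brokenBonds u N) (u N) = 0)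
    (hstab : ∃ γ : ℝ, 0 < γ ∧ M.StabilityAbove (M.brokenBonds u N) (u N) γ)
    (hker : M.TrivialKernelL2 (M.brokenBonds u N) (u N)) :
    (M.lin (M.brokenBonds u N) (u N)).IsInvertible ∧
    (∃ K : ℝ, 0 < K ∧ ∀ w w' : M.Linf,
      ‖M.lin (M.brokenBonds u N) w - M.lin (M.brokenBonds u N) w'‖ ≤ K * ‖w - w'‖) ∧
    ∀ K : ℝ, 0 < K →
      (∀ w w' : M.Linf,
        ‖M.lin (M.brokenBonds u N) w - M.lin (M.brokenBonds u N) w'‖ ≤ K * ‖w - w'‖) →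
    ∀ β : ℝ, ‖(M.lin (M.brokenBonds u N) (u N)).inverse‖ < β →
    ∀ η : ℝ, 0 < η → ∀ h : ℝ, h = β * K * η → h < 1 / 2 →
    ∀ t₁ t₂ : ℝ, t₁ = 1 / (β * K) * (1 - √(1 - 2 * h)) → t₂ = 1 / (β * K) * (1 + √(1 - 2 * h)) →
    ∃ δ : ℝ, 0 < δ ∧ ∀ U : M.B, ‖U - UN‖ ≤ δ →
      (M.lin (M.brokenBonds u N) (vN + U)).IsInvertible ∧
      ‖(M.lin (M.brokenBonds u N) (vN + U)).inverse‖ < β ∧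
      ‖(M.lin (M.brokenBonds u N) (vN + U)).inverse (M.force (M.brokenBonds u N) (vN + U))‖ ≤ η ∧
      0 < t₁ ∧ t₁ < t₂ ∧
      (∀ v ∈ Metric.closedBall vN t₁, (M.lin (M.brokenBonds u N) (v + U)).IsInvertible) ∧
      (h < 4 / 9 → Set.MapsTo (M.newtonMap (M.brokenBonds u N) U)
        (Metric.closedBall vN t₁) (Metric.closedBall vN t₁)) ∧
      ∃ v' ∈ Metric.closedBall vN t₁,
        M.newtonMap (M.brokenBonds u N) U v' = v' ∧
        (∀ v ∈ Metric.closedBall vN t₁, M.newtonMap (M.brokenBonds u N) U v = v → v = v') ∧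
        (∀ v ∈ Metric.closedBall vN t₂, (M.lin (M.brokenBonds u N) (v + U)).IsInvertible →
          M.newtonMap (M.brokenBonds u N) U v = v → v = v') ∧
        (∀ v ∈ Metric.closedBall vN t₂, M.force (M.brokenBonds u N) (v + U) = 0 → v = v') ∧
        M.force (M.brokenBonds u N) (v' + U) = 0 ∧
        M.force (M.breakBonds (M.brokenBonds u N) (v' + U)) (v' + U) = 0 := by
  obtain ⟨γ, hγ, hstab⟩ := hstab
  set S := M.brokenBonds u N
  have hinvN := M.lin_isInvertible hγ hstab hker
  refine ⟨hinvN, M.exists_lin_sub_le S, ?_⟩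
  intro K hK0 hK β hβ η hη h hh hhalf t₁ t₂ ht₁ ht₂
  set b := ‖(M.lin S (u N)).inverse‖ with hb
  have hb0 : 0 ≤ b := ContinuousLinearMap.opNorm_nonneg _
  have hβ0 : 0 < β := hb0.trans_lt hβ
  have hβK : 0 < β * K := mul_pos hβ0 hK0
  have hh0 : 0 < h := hh ▸ mul_pos hβK hη
  -- the arithmetic of the majorant polynomial `β K t² / 2 - t + η`, with roots `t₁`, `t₂`
  set q := √(1 - 2 * h) with hq
  have hq2 : q ^ 2 = 1 - 2 * h := Real.sq_sqrt (by linarith)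
  have hq0 : 0 < q := Real.sqrt_pos.2 (by linarith)
  have hq1 : q < 1 := by nlinarith
  have hKt₁ : β * K * t₁ = 1 - q := by rw [ht₁]; field_simp
  have hKt₂ : β * K * t₂ = 1 + q := by rw [ht₂]; field_simp
  have ht₁0 : 0 < t₁ := by rw [ht₁]; exact mul_pos (by positivity) (by linarith)
  have ht₁₂ : t₁ < t₂ := by
    rw [ht₁, ht₂]
    exact mul_lt_mul_of_pos_left (by linarith) (by positivity)
  have hroot : η = t₁ - β * K * t₁ ^ 2 / 2 := by
    refine mul_left_cancel₀ hβK.ne' ?_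
    have : β * K * (t₁ - β * K * t₁ ^ 2 / 2) = β * K * t₁ - (β * K * t₁) ^ 2 / 2 := by ring
    rw [this, hKt₁, ← hh]
    linarith
  -- `θ` bounds the Newton step for which `T` preserves the ball
  obtain ⟨θ, hθ0, hθ⟩ : ∃ θ, 0 < θ ∧ (h < 4 / 9 → θ ≤ t₁ - 3 / 2 * (β * K * t₁ ^ 2)) := by
    by_cases h49 : h < 4 / 9
    · refine ⟨t₁ - 3 / 2 * (β * K * t₁ ^ 2), ?_, fun _ => le_rfl⟩
      have h1 : t₁ - 3 / 2 * (β * K * t₁ ^ 2) = t₁ * (1 - 3 / 2 * (β * K * t₁)) := by ring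
      rw [h1, hKt₁]
      have : 1 / 3 < q := by nlinarith
      exact mul_pos ht₁0 (by linarith)
    · exact ⟨1, one_pos, fun hlt => absurd hlt h49⟩
  obtain ⟨C, hC0, hC⟩ := M.exists_force_sub_le S
  obtain ⟨δ, hδ0, hδ₁, hδ₂⟩ := Peridynamics.exists_pos_mul_lt (a₁ := β * (b * K)) (a₂ := β * C)
    (c₁ := β - b) (c₂ := min η θ) (by positivity) (by positivity) (by linarith)
    (lt_min hη hθ0)
  refine ⟨δ, hδ0, fun U hU => ?_⟩
  have hdist : ‖((vN : M.Linf) + U) - u N‖ ≤ δ := by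
    rw [huN, add_sub_add_left_eq_sub]
    exact hU
  have hbd : b * (K * δ) < 1 := by
    refine lt_of_mul_lt_mul_left ?_ hβ0.le
    linarith
  obtain ⟨hinv, hle⟩ := NewtonKantorovich.isInvertible_of_norm_sub_le hinvN hb.ge
    ((hK (vN + U) (u N)).trans (mul_le_mul_of_nonneg_left hdist hK0.le)) hbd
  have hinvβ : ‖(M.lin S (vN + U)).inverse‖ < β := by
    have h1 : 0 < 1 - b * (K * δ) := by linarith
    refine lt_of_le_of_lt (ContinuousLinearMap.opNorm_le_bound _
      (div_nonneg hb0 h1.le) fun y => ?_) ((div_lt_iff₀ h1).2 (by linarith) : b / _ < β)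
    rw [div_mul_eq_mul_div, le_div_iff₀ h1, mul_comm]
    exact (hle y).trans ((M.lin S (u N)).inverse.le_opNorm y)
  have hstep : ‖(M.lin S (vN + U)).inverse (M.force S (vN + U))‖ ≤ min η θ := by
    have h1 : ‖M.force S (vN + U)‖ ≤ C * δ := by
      have := hC (vN + U) (u N)
      rw [hsol, sub_zero] at this
      exact this.trans (mul_le_mul_of_nonneg_left hdist hC0)
    refine ((M.lin S (vN + U)).inverse.le_of_opNorm_le hinvβ.le _).trans ?_
    refine (mul_le_mul_of_nonneg_left h1 hβ0.le).trans ?_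
    linarith
  have hF := M.hasFDerivAt_force S U
  have hLip : ∀ v w : M.V, ‖M.lin S (v + U) - M.lin S (w + U)‖ ≤ K * ‖v - w‖ := fun v w => by
    have := hK (v + U) (w + U)
    rwa [add_sub_add_right_eq_sub] at this
  have ht : β * K * t₁ < 1 := by linarith
  have hball : ∀ v ∈ Metric.closedBall vN t₁, (M.lin S (v + U)).IsInvertible := fun v hv =>
    (NewtonKantorovich.isInvertible_of_mem_closedBall hLip hK0 hinv hinvβ ht hv).1
  obtain ⟨v', hv', hzero, huniq⟩ := NewtonKantorovich.exists_zero hF hLip hK0 hinv hinvβ ht₁0.le ht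
    (show β * K * (t₁ + t₂) = 2 by linarith) (hstep.trans ((min_le_left _ _).trans hroot.le))
  -- fixed points of the Newton map are zeros of the force
  have hfix : ∀ v : M.V, (M.lin S (v + U)).IsInvertible → M.newtonMap S U v = v →
      M.force S (v + U) = 0 := fun v hvi hv => by
    rw [Peridynamics.Model.newtonMap, sub_eq_self] at hv
    rw [← hvi.self_apply_inverse (M.force S (v + U)), hv, map_zero]
  refine ⟨hinv, hinvβ, hstep.trans (min_le_left _ _), ht₁0, ht₁₂, hball, fun h49 => ?_, v', hv', ?_,
    fun v hv hTv => huniq v (Metric.closedBall_subset_closedBall ht₁₂.le hv)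
      (hfix v (hball v hv) hTv),
    fun v hv hvi hTv => huniq v hv (hfix v hvi hTv), huniq, hzero, ?_⟩
  · exact NewtonKantorovich.mapsTo_newton hF hLip hK0 hinv hinvβ ht
      (hstep.trans ((min_le_right _ _).trans (hθ h49)))
  · have hzero' : M.force S (v' + U) = 0 := hzero
    rw [Peridynamics.Model.newtonMap, hzero', map_zero, sub_zero]
  · rw [M.force_breakBonds]
    exact hzero
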